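/- Let $0<\alpha<1/4$ and $\sigma_\alpha=\{s\in\mathbb{C}:\operatorname{Re}s=\alpha\}$. Let $f,g\in L_2(\mathbb{R}_+;x^{2\alpha-1}dx)$ be complex-valued with Mellin transforms $f^*,g^*\in L_2(\sigma_\alpha)$, where $f^*(s)=\int_0^\infty f(t)t^{s-1}\,dt$ is understood as the limit of $\int_{1/N}^{N}f(t)t^{s-1}\,dt$ in $L_2(\sigma_\alpha)$ as $N\to\infty$. Assume that $sf^*(s),\,sg^*(s)\in L_2(\sigma_\alpha)$. For $x>0$ put $$(f*g)(x)=\frac{1}{(2\pi i)^2}\int_{\sigma_\alpha}\int_{\sigma_\alpha}\frac{\cot(\pi s)\cot(\pi w)}{\cot(\pi(s+w))}\,f^*(s)\,g^*(w)\,x^{-s-w}\,ds\,dw,\qquad (H_+f)(x)=\frac1\pi\,\mathrm{PV}\!\int_0^\infty\frac{f(t)}{t-x}\,dt .$$ Then: 1. The double integral defining $(f*g)(x)$ converges absolutely for every $x>0$, $f*g\in L_2(\mathbb{R}_+;x^{4\alpha-1}dx)$, and the Mellin transform of $f*g$ on $\sigma_{2\alpha}$ (in the mean square sense) belongs to $L_2(\sigma_{2\alpha})$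 and is equal to $$(\mathcal{M}(f*g))(s)=\frac{1}{2\pi i\cot(\pi s)}\int_{\sigma_\alpha}\cot(\pi(s-w))\cot(\pi w)\,f^*(s-w)\,g^*(w)\,dw,\qquad s\in\sigma_{2\alpha},$$ where the integral converges absolutely for every $s\in\sigma_{2\alpha}$. 2. For every $x>0$ the principal values $(H_+f)(x)$, $(H_+g)(x)$, $(H_+(f*g))(x)$ exist and $$(H_+(f*g))(x)=(H_+f)(x)\,(H_+g)(x).$$ 3. The inversion formulas $f(x)=\frac1{2\pi i}\int_{\sigma_\alpha}f^*(s)x^{-s}ds$ and $g(x)=\frac1{2\pi i}\int_{\sigma_\alpha}g^*(s)x^{-s}ds$ hold for almost every $x>0$. If in addition $sf^*(s),\,sg^*(s)\in L_1(\sigma_\alpha)$, then for every $x>0$ at which both of them hold (hence for all $x>0$ when $f$ and $g$ are normalized on a null set to be given by them) $$(f*g)(x)=(H_+g)(x)\,f(x)-\frac1\pi\int_0^\infty f(t)\,\frac{\sqrt{x}\,g(t)-\sqrt{t}\,g(x)}{t-x}\,\frac{dt}{\sqrt t},$$ where the last integral converges absolutely. -/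

import Mathlib

open MeasureTheory Set Filter Topology

noncomputable section

namespace HalfHilbert

/-- The point `α + iτ` of the vertical line `σ_α = {s : Re s = α}`. -/
def vpt (α τ : ℝ) : ℂ := (α : ℂ) + (τ : ℂ) * Complex.I

/-- The contour integral `∫_{σ_α} Φ(s) ds`, with `s = α + iτ`, `ds = i dτ`. -/
def vintegral (α : ℝ) (Φ : ℂ → ℂ) : ℂ := Complex.I * ∫ τ : ℝ, Φ (vpt α τ)

/-- The double contour integral `∫_{σ_α} ∫_{σ_α} Φ(s, w) ds dw`. -/
def vintegral₂ (α : ℝ) (Φ : ℂ → ℂ → ℂ) : ℂ :=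
  Complex.I ^ 2 * ∫ p : ℝ × ℝ, Φ (vpt α p.1) (vpt α p.2)

/-- `Φ ∈ L_p(σ_α)`, with respect to `|ds| = dτ`. -/
def MemLpLine (Φ : ℂ → ℂ) (p : ENNReal) (α : ℝ) : Prop :=
  MemLp (fun τ : ℝ => Φ (vpt α τ)) p volume

/-- The measure `x^{2α-1} dx` on `(0, ∞)`. -/
def weightMeasure (α : ℝ) : Measure ℝ :=
  (volume.restrict (Ioi (0 : ℝ))).withDensity fun x => ENNReal.ofReal (x ^ (2 * α - 1))

/-- `F` is the mean-square Mellin transform of `f` on `σ_α`: `f ∈ L_2(ℝ₊; x^{2α-1} dx)`,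
`F ∈ L_2(σ_α)`, and `∫_{1/N}^N f(t) t^{s-1} dt → F(s)` in `L_2(σ_α)` as `N → ∞`.
Only the values of `F` on `σ_α` and of `f` on `(0, ∞)` matter. -/
def IsMellin (α : ℝ) (f : ℝ → ℂ) (F : ℂ → ℂ) : Prop :=
  MemLp f 2 (weightMeasure α) ∧
  MemLpLine F 2 α ∧
  Tendsto
    (fun N : ℝ =>
      eLpNorm
        (fun τ : ℝ => (∫ t in Ioc N⁻¹ N, f t * (t : ℂ) ^ (vpt α τ - 1)) - F (vpt α τ))
        2 volume)
    atTop (𝓝 0)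

/-- The inversion integral `(1/2πi) ∫_{σ_α} F(s) x^{-s} ds`. -/
def mellinInversion (α : ℝ) (F : ℂ → ℂ) (x : ℝ) : ℂ :=
  1 / (2 * Real.pi * Complex.I) * vintegral α fun s => F s * (x : ℂ) ^ (-s)

/-- The domain of integration of the truncated half-Hilbert transform at `x`. -/
def truncDomain (x ε : ℝ) : Set ℝ := {t : ℝ | 0 < t ∧ ε < |t - x|}

/-- The truncated half-Hilbert transform. -/
def truncHilbert (f : ℝ → ℂ) (x ε : ℝ) : ℂ :=
  1 / (Real.pi : ℂ) * ∫ t in truncDomain x ε, f t / ((t : ℂ) - (x : ℂ))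

/-- The half-Hilbert transform `(H₊ f)(x) = (1/π) PV ∫_0^∞ f(t)/(t-x) dt`. -/
def halfHilbert (f : ℝ → ℂ) (x : ℝ) : ℂ := limUnder (𝓝[>] (0 : ℝ)) (truncHilbert f x)

/-- The principal value integral which defines `(H₊ f)(x)` exists: the truncated integrals
converge absolutely and tend to `(H₊ f)(x)`. -/
def HalfHilbertExists (f : ℝ → ℂ) (x : ℝ) : Prop :=
  (∀ ε : ℝ, 0 < ε →
    IntegrableOn (fun t : ℝ => f t / ((t : ℂ) - (x : ℂ))) (truncDomain x ε)) ∧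
  Tendsto (truncHilbert f x) (𝓝[>] (0 : ℝ)) (𝓝 (halfHilbert f x))

/-- The integrand of the convolution at `x`; `F`, `G` are the Mellin transforms of the factors. -/
def convKernel (F G : ℂ → ℂ) (x : ℝ) (s w : ℂ) : ℂ :=
  Complex.cot (Real.pi * s) * Complex.cot (Real.pi * w) / Complex.cot (Real.pi * (s + w))
    * F s * G w * (x : ℂ) ^ (-s - w)

/-- The convolution `(f * g)(x)` related to the half-Hilbert transform, a double Mellin-Barnes
integral in the Mellin transforms `F`, `G` of `f`, `g` on `σ_α`. -/
def conv (α : ℝ) (F G : ℂ → ℂ) (x : ℝ) : ℂ :=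
  1 / (2 * Real.pi * Complex.I) ^ 2 * vintegral₂ α (convKernel F G x)

/-- `w ↦ cot(π(s-w)) cot(πw) F(s-w) G(w)`. -/
def convMellinKernel (F G : ℂ → ℂ) (s w : ℂ) : ℂ :=
  Complex.cot (Real.pi * (s - w)) * Complex.cot (Real.pi * w) * F (s - w) * G w

/-- `s ↦ (1/(2πi cot(πs))) ∫_{σ_α} cot(π(s-w)) cot(πw) F(s-w) G(w) dw`. -/
def convMellin (α : ℝ) (F G : ℂ → ℂ) (s : ℂ) : ℂ :=
  1 / (2 * Real.pi * Complex.I * Complex.cot (Real.pi * s))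
    * vintegral α (convMellinKernel F G s)

/-- `t ↦ f(t) (√x g(t) - √t g(x)) / ((t - x) √t)`. -/
def reprIntegrand (f g : ℝ → ℂ) (x t : ℝ) : ℂ :=
  f t * (((√x : ℝ) : ℂ) * g t - ((√t : ℝ) : ℂ) * g x) / ((t : ℂ) - (x : ℂ))
    / ((√t : ℝ) : ℂ)

end HalfHilbert

end

open HalfHilbert

/-!
On the Mellin side the half-Hilbert transform is the multiplication by `cot (π s)`, and this turns
every claim into an identity between convolutions on vertical lines.

The integral `PV ∫ t ^ (-s) / (t - x) dt` equals `π cot (π s) x ^ (-s)` for `0 < Re s < 1`: after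
scaling to `x = 1`, the substitution `t ↦ 1 / t` on `t > 1` gives the convergent integral of
`(u ^ (s - 1) - u ^ (-s)) / (1 - u)` over `(0, 1)`, which a geometric series expands into the partial
fractions of the cotangent (`integral_reflKernel`). Since `u ^ (-s)` is Hölder continuous of order
`1/4` at `u = 1` with a constant of order `|s| ^ (1/4)`, the truncated integrals are bounded by
`(1 + |Im s|) ^ (1/4)` uniformly in the truncation. For a function `f` which is the inverse Mellin
transform of some `p` with `(1 + |τ|) ^ (1/4) p` integrable, Fubini and dominated convergence then
give the existence of `H₊ f` at every point and its value (`halfHilbert_invLine`). This weighted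
integrability follows from `F`, `s F ∈ L²` by Cauchy–Schwarz, and it is inherited by convolutions.

The passage between `f` and its mean-square Mellin transform is Plancherel's theorem in logarithmic
coordinates (`isMellin_invLine`, `IsMellin.ae_eq_invLine`). A double inversion integral with a
multiplier depending on `s + w` is an inversion integral over the doubled line
(`double_integral_eq_invLine`). Hence the convolution is the inverse Mellin transform of
`tan (π s)` times the convolution of `cot (π s) F` and `cot (π s) G`; multiplying by `cot (π s)`
cancels the tangent and leaves the product of the half-Hilbert transforms.

For the representation, `cot a cot b / cot (a + b) = tan (a + b) + cot a + cot b` splits the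
convolution into `(H₊ f) g + f (H₊ g)` and a term with the symbol `tan (π s) = -cot (π (s + 1/2))`.
The latter is `-√x` times the half-Hilbert transform of `f g / √t`, whose Mellin transform lives on
`Re s = 2α + 1/2 < 1` (`conv_eq_repr`). The principal values of `f` and `f g / √t` combine into one
absolutely convergent integral, because `g / √t` is Hölder continuous.
-/

noncomputable section

namespace HalfHilbert

/-! ### The kernel on the vertical lines and its integral over `(0, 1)` -/

/-- The weight `(1 + |τ|)^{1/4}`. Any exponent in `(0, 1/2)` would do: it has to be positive for the
principal values and below `1/2` for the Cauchy–Schwarz inequality in `weightedL1_of_memLpLine`. -/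
def wt (τ : ℝ) : ℝ := (1 + |τ|) ^ (1 / 4 : ℝ)

theorem one_le_wt (τ : ℝ) : 1 ≤ wt τ :=
  Real.one_le_rpow (by linarith [abs_nonneg τ]) (by norm_num)

theorem wt_pos (τ : ℝ) : 0 < wt τ := zero_lt_one.trans_le (one_le_wt τ)

theorem continuous_wt : Continuous wt := by
  unfold wt
  exact Continuous.rpow_const (by fun_prop) fun τ => Or.inr (by norm_num)

theorem wt_sub_mul_le (τ θ : ℝ) : wt τ ≤ wt (τ - θ) * wt θ := by
  unfold wt
  rw [← Real.mul_rpow (by positivity) (by positivity)]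
  refine Real.rpow_le_rpow (by positivity) ?_ (by norm_num)
  have h := abs_add_le (τ - θ) θ
  rw [sub_add_cancel] at h
  nlinarith [mul_nonneg (abs_nonneg (τ - θ)) (abs_nonneg θ)]

@[simp] theorem vpt_re (α τ : ℝ) : (vpt α τ).re = α := by simp [vpt]

@[simp] theorem vpt_im (α τ : ℝ) : (vpt α τ).im = τ := by simp [vpt]

theorem continuous_vpt (α : ℝ) : Continuous (vpt α) := by unfold vpt; fun_prop

/-- The cotangent is bounded on vertical lines through `a` with `sin a > 0`, since
`|sin (a + iy)|² = sin² a + sinh² y` and `|cos (a + iy)|² = cos² a + sinh² y`. -/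
theorem norm_cot_add_mul_I_le {a : ℝ} (ha : 0 < Real.sin a) (y : ℝ) :
    ‖Complex.cot (a + y * Complex.I)‖ ≤ (Real.sin a)⁻¹ := by
  have hs : Complex.normSq (Complex.sin (a + y * Complex.I))
      = Real.sin a ^ 2 + Real.sinh y ^ 2 := by
    rw [Complex.sin_eq]
    simp only [Complex.add_re, Complex.ofReal_re, Complex.mul_re, Complex.I_re, Complex.ofReal_im,
      Complex.I_im, Complex.add_im, Complex.mul_im, mul_zero, mul_one, sub_zero, add_zero, zero_add]
    rw [← Complex.ofReal_sin, ← Complex.ofReal_cos, ← Complex.ofReal_cosh, ← Complex.ofReal_sinh,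
      ← Complex.ofReal_mul, ← Complex.ofReal_mul, Complex.normSq_add_mul_I]
    nlinarith [Real.cosh_sq y, Real.sin_sq_add_cos_sq a]
  have hc : Complex.normSq (Complex.cos (a + y * Complex.I))
      = Real.cos a ^ 2 + Real.sinh y ^ 2 := by
    rw [Complex.cos_eq]
    simp only [Complex.add_re, Complex.ofReal_re, Complex.mul_re, Complex.I_re, Complex.ofReal_im,
      Complex.I_im, Complex.add_im, Complex.mul_im, mul_zero, mul_one, sub_zero, add_zero, zero_add]
    rw [← Complex.ofReal_sin, ← Complex.ofReal_cos, ← Complex.ofReal_cosh, ← Complex.ofReal_sinh,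
      ← Complex.ofReal_mul, ← Complex.ofReal_mul, sub_eq_add_neg, ← neg_mul, ← Complex.ofReal_neg,
      Complex.normSq_add_mul_I]
    nlinarith [Real.cosh_sq y, Real.sin_sq_add_cos_sq a]
  rw [Complex.cot, norm_div, Complex.norm_def, Complex.norm_def, hs, hc,
    ← Real.sqrt_div (by positivity)]
  apply Real.sqrt_le_iff.2 ⟨by positivity, ?_⟩
  rw [inv_pow, div_le_iff₀ (by positivity), inv_mul_eq_div, le_div_iff₀ (by positivity)]
  nlinarith [Real.sin_sq_add_cos_sq a, sq_nonneg (Real.cos a), sq_nonneg (Real.sinh y),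
    mul_nonneg (sq_nonneg (Real.cos a)) (sq_nonneg (Real.sinh y)), sq_nonneg (Real.sin a),
    sq_nonneg (Real.cos a ^ 2)]

theorem norm_cot_vpt_le {β : ℝ} (h0 : 0 < β) (h1 : β < 1) (τ : ℝ) :
    ‖Complex.cot (Real.pi * vpt β τ)‖ ≤ (Real.sin (Real.pi * β))⁻¹ := by
  have h := norm_cot_add_mul_I_le (a := Real.pi * β) (Real.sin_pos_of_pos_of_lt_pi (by positivity)
    (by nlinarith [Real.pi_pos])) (Real.pi * τ)
  convert h using 3
  simp [vpt]; ring

theorem measurable_cot : Measurable Complex.cot := by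
  have : Complex.cot = fun z => Complex.cos z / Complex.sin z := rfl
  rw [this]
  exact Complex.continuous_cos.measurable.div Complex.continuous_sin.measurable

theorem measurable_cot_vpt (β : ℝ) : Measurable fun τ => Complex.cot (Real.pi * vpt β τ) :=
  measurable_cot.comp (by have := continuous_vpt β; fun_prop)

/-- The power `u ^ (-s)` is Hölder continuous of order `1/4` near `u = 1`, with a constant that
grows like `|s| ^ (1/4)`. -/
theorem norm_cpow_neg_sub_one_le {s : ℂ} (h0 : 0 < s.re) (h1 : s.re < 1) {u : ℝ}
    (hu : 1 / 2 ≤ u) : ‖(u : ℂ) ^ (-s) - 1‖ ≤ 4 * (wt s.im * |u - 1| ^ (1 / 4 : ℝ)) := by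
  have key : ∀ r : ℝ, r < 2 → 0 < r → ∀ v : ℝ, 1 / 2 ≤ v → v ^ (-r) ≤ 2 ^ r := by
    intro r _ hr v hv
    rw [Real.rpow_neg (by linarith), ← Real.inv_rpow (by linarith)]
    refine Real.rpow_le_rpow (by positivity) ?_ hr.le
    rw [inv_le_comm₀ (by linarith) (by norm_num)]; linarith
  have hA : ‖(u : ℂ) ^ (-s) - 1‖ ≤ 4 := by
    refine (norm_sub_le _ _).trans ?_
    rw [Complex.norm_cpow_eq_rpow_re_of_pos (by linarith), norm_one, Complex.neg_re]
    have h2 := key s.re (by linarith) h0 u hu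
    have h3 : (2 : ℝ) ^ s.re ≤ 2 ^ (1 : ℝ) := Real.rpow_le_rpow_of_exponent_le (by norm_num) h1.le
    rw [Real.rpow_one] at h3
    linarith
  have hs : ‖s‖ ≤ 1 + |s.im| := by
    refine (Complex.norm_le_abs_re_add_abs_im s).trans ?_
    rw [abs_of_pos h0]; linarith
  have hB : ‖(u : ℂ) ^ (-s) - 1‖ ≤ 4 * ((1 + |s.im|) * |u - 1|) := by
    have hd : ∀ v ∈ Ici (1 / 2 : ℝ), HasDerivWithinAt (fun v : ℝ => (v : ℂ) ^ (-s))
        (-s * (v : ℂ) ^ (-s - 1)) (Ici (1 / 2)) v := by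
      intro v hv
      have hv' : (0 : ℝ) < v := lt_of_lt_of_le (by norm_num) hv
      have := ((hasDerivAt_id (v : ℂ)).cpow_const (c := -s) (Or.inl (by simpa using hv'))).comp_ofReal
      simpa using this.hasDerivWithinAt
    have hb : ∀ v ∈ Ici (1 / 2 : ℝ), ‖-s * (v : ℂ) ^ (-s - 1)‖ ≤ 4 * (1 + |s.im|) := by
      intro v hv
      have hv' : (0 : ℝ) < v := lt_of_lt_of_le (by norm_num) hv
      rw [norm_mul, norm_neg, Complex.norm_cpow_eq_rpow_re_of_pos hv']
      have h2 := key (s.re + 1) (by linarith) (by linarith) v hv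
      have h3 : (2 : ℝ) ^ (s.re + 1) ≤ 2 ^ (2 : ℝ) :=
        Real.rpow_le_rpow_of_exponent_le (by norm_num) (by linarith)
      have h4 : (-s - 1).re = -(s.re + 1) := by simp; ring
      rw [h4]
      norm_num at h3
      have := mul_le_mul hs (h2.trans h3) (by positivity) (by positivity)
      linarith
    have := Convex.norm_image_sub_le_of_norm_hasDerivWithin_le hd hb (convex_Ici _)
      (show (1 : ℝ) ∈ Ici (1 / 2 : ℝ) by norm_num) hu
    simpa [mul_assoc] using this
  set a := (1 + |s.im|) * |u - 1| with ha
  have ha0 : 0 ≤ a := by positivity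
  have h4 : wt s.im * |u - 1| ^ (1 / 4 : ℝ) = a ^ (1 / 4 : ℝ) := by
    rw [wt, ← Real.mul_rpow (by positivity) (by positivity)]
  rw [h4]
  rcases le_total a 1 with h | h
  · have := Real.self_le_rpow_of_le_one ha0 h (show (1 / 4 : ℝ) ≤ 1 by norm_num)
    linarith
  · have := Real.one_le_rpow h (show (0 : ℝ) ≤ 1 / 4 by norm_num)
    linarith

theorem integrableOn_abs_sub_rpow (x : ℝ) {a b : ℝ} (hab : a ≤ b) :
    IntegrableOn (fun t : ℝ => |t - x| ^ (-(3 / 4) : ℝ)) (Ioc a b) := by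
  have h : IntervalIntegrable (fun t : ℝ => |t| ^ (-(3 / 4) : ℝ)) volume (a - x) (b - x) := by
    have h1 : ∀ c : ℝ, 0 ≤ c → IntervalIntegrable (fun t : ℝ => |t| ^ (-(3 / 4) : ℝ)) volume 0 c := by
      intro c hc
      refine (intervalIntegral.intervalIntegrable_rpow' (a := 0) (b := c) (r := -(3 / 4))
        (by norm_num)).congr ?_
      intro t ht
      rw [uIoc_of_le hc] at ht
      simp only [abs_of_pos ht.1]
    have h2 : ∀ c : ℝ, IntervalIntegrable (fun t : ℝ => |t| ^ (-(3 / 4) : ℝ)) volume 0 c := by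
      intro c
      rcases le_total 0 c with hc | hc
      · exact h1 c hc
      · have := (IntervalIntegrable.iff_comp_neg).1 (h1 (-c) (by linarith))
        simpa using this
    exact (h2 _).symm.trans (h2 _)
  have h3 := h.comp_sub_right x
  simp only [sub_add_cancel] at h3
  exact (intervalIntegrable_iff_integrableOn_Ioc_of_le hab).1 h3

/-- An integrable majorant of `(u ^ (s - 1) - u ^ (-s)) / (1 - u)` on `(0, 1)`, up to the weight
of `Im s`. -/
def kernelBound (β u : ℝ) : ℝ := 8 * |u - 1| ^ (-(3 / 4) : ℝ) + 2 * (u ^ (β - 1) + u ^ (-β))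

theorem integrableOn_kernelBound {β : ℝ} (h0 : 0 < β) (h1 : β < 1) :
    IntegrableOn (kernelBound β) (Ioc 0 1) := by
  have A := integrableOn_abs_sub_rpow 1 (zero_le_one' ℝ)
  have B := (intervalIntegrable_iff_integrableOn_Ioc_of_le (zero_le_one' ℝ)).1
    (intervalIntegral.intervalIntegrable_rpow' (a := 0) (b := 1) (r := β - 1) (by linarith))
  have C := (intervalIntegrable_iff_integrableOn_Ioc_of_le (zero_le_one' ℝ)).1
    (intervalIntegral.intervalIntegrable_rpow' (a := 0) (b := 1) (r := -β) (by linarith))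
  exact (A.const_mul 8).add ((B.add C).const_mul 2)

/-- The reflected kernel on `(0, 1)`: the part `t > 1` of `∫ t ^ (-s) / (t - 1) dt` is mapped to
`(0, 1)` by `t = 1 / u`. -/
def reflKernel (s : ℂ) (u : ℝ) : ℂ := ((u : ℂ) ^ (s - 1) - (u : ℂ) ^ (-s)) / (1 - u)

theorem norm_reflKernel_le {s : ℂ} (h0 : 0 < s.re) (h1 : s.re < 1) {u : ℝ} (hu : u ∈ Ioo (0 : ℝ) 1) :
    ‖reflKernel s u‖ ≤ wt s.im * kernelBound s.re u := by
  have hu1 : 0 < 1 - u := by linarith [hu.2]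
  have hn : ‖(1 - u : ℂ)‖ = 1 - u := by
    rw [← Complex.ofReal_one, ← Complex.ofReal_sub, Complex.norm_real, Real.norm_of_nonneg hu1.le]
  have habs : |u - 1| = 1 - u := by rw [abs_sub_comm, abs_of_pos hu1]
  have hw := one_le_wt s.im
  have hp1 : 0 ≤ u ^ (s.re - 1) := Real.rpow_nonneg hu.1.le _
  have hp2 : 0 ≤ u ^ (-s.re) := Real.rpow_nonneg hu.1.le _
  have hp3 : 0 ≤ (1 - u) ^ (-(3 / 4) : ℝ) := Real.rpow_nonneg hu1.le _
  rw [reflKernel, norm_div, hn, div_le_iff₀ hu1, kernelBound, habs]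
  -- near `u = 1` both powers are compared with `1`; near `u = 0` they are bounded separately
  rcases le_total (1 / 2) u with h | h
  · have e1 := norm_cpow_neg_sub_one_le h0 h1 h
    have e2 := norm_cpow_neg_sub_one_le (s := 1 - s) (by simpa using h1) (by simpa using h0) h
    have him : wt (1 - s).im = wt s.im := by simp [wt]
    rw [him] at e2
    have e3 : ‖(u : ℂ) ^ (s - 1) - (u : ℂ) ^ (-s)‖ ≤ 8 * (wt s.im * |u - 1| ^ (1 / 4 : ℝ)) := by
      have : (u : ℂ) ^ (s - 1) - (u : ℂ) ^ (-s)
          = ((u : ℂ) ^ (-(1 - s)) - 1) - ((u : ℂ) ^ (-s) - 1) := by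
        rw [neg_sub]; ring
      rw [this]
      refine (norm_sub_le _ _).trans ?_
      linarith
    refine e3.trans ?_
    rw [habs]
    have e4 : (1 - u) ^ (1 / 4 : ℝ) = (1 - u) ^ (-(3 / 4) : ℝ) * (1 - u) := by
      conv_rhs => rw [← Real.rpow_add_one hu1.ne']
      norm_num
    rw [e4]
    have : 0 ≤ wt s.im * (2 * (u ^ (s.re - 1) + u ^ (-s.re))) * (1 - u) := by positivity
    nlinarith
  · have e3 : ‖(u : ℂ) ^ (s - 1) - (u : ℂ) ^ (-s)‖ ≤ u ^ (s.re - 1) + u ^ (-s.re) := by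
      refine (norm_sub_le _ _).trans ?_
      rw [Complex.norm_cpow_eq_rpow_re_of_pos hu.1, Complex.norm_cpow_eq_rpow_re_of_pos hu.1]
      simp
    refine e3.trans ?_
    have e5 : 0 ≤ 8 * (1 - u) ^ (-(3 / 4) : ℝ) * (1 - u) := by positivity
    have e6 : u ^ (s.re - 1) + u ^ (-s.re)
        ≤ (8 * (1 - u) ^ (-(3 / 4) : ℝ) + 2 * (u ^ (s.re - 1) + u ^ (-s.re))) * (1 - u) := by
      nlinarith
    refine e6.trans ?_
    have : 0 ≤ (8 * (1 - u) ^ (-(3 / 4) : ℝ) + 2 * (u ^ (s.re - 1) + u ^ (-s.re))) * (1 - u) := by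
      positivity
    nlinarith

theorem measurable_reflKernel (s : ℂ) : Measurable (reflKernel s) := by
  unfold reflKernel
  fun_prop

theorem integrableOn_reflKernel {s : ℂ} (h0 : 0 < s.re) (h1 : s.re < 1) :
    IntegrableOn (reflKernel s) (Ioo 0 1) := by
  refine (((integrableOn_kernelBound h0 h1).mono_set Ioo_subset_Ioc_self).const_mul (wt s.im)).mono'
    (measurable_reflKernel s).aestronglyMeasurable ?_
  filter_upwards [ae_restrict_mem measurableSet_Ioo] with u hu
  exact norm_reflKernel_le h0 h1 hu

theorem mem_integerComplement {s : ℂ} (h0 : 0 < s.re) (h1 : s.re < 1) :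
    s ∈ Complex.integerComplement := by
  rintro ⟨n, rfl⟩
  simp only [Complex.intCast_re] at h0 h1
  have h2 : 0 < n := by exact_mod_cast h0
  have h3 : n < 1 := by exact_mod_cast h1
  omega

/-- The partial sums of the cotangent series; the last term is what the pairing of `1 / (s + n)`
with `1 / (s - n - 1)` leaves over. -/
theorem integral_reflKernel_mul {s : ℂ} (h0 : 0 < s.re) (h1 : s.re < 1) (N : ℕ) :
    ∫ u in Ioo (0 : ℝ) 1, reflKernel s u * (1 - (u : ℂ) ^ N)
      = 1 / s + ∑ n ∈ Finset.range N, cotTerm s n - 1 / (s + N) := by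
  have hs : s ∈ Complex.integerComplement := mem_integerComplement h0 h1
  have hne : ∀ z : ℂ, 0 < z.re → z ≠ 0 := by
    rintro z hz rfl; simp at hz
  have step : ∀ n : ℕ, IntegrableOn (fun u : ℝ => (u : ℂ) ^ (s - 1 + n) - (u : ℂ) ^ (-s + n)) (Ioo 0 1)
      ∧ ∫ u in Ioo (0 : ℝ) 1, ((u : ℂ) ^ (s - 1 + n) - (u : ℂ) ^ (-s + n))
        = 1 / (s + n) - 1 / (n + 1 - s) := by
    intro n
    have hn : (0 : ℝ) ≤ n := n.cast_nonneg
    have r1 : -1 < (s - 1 + n).re := by simp; linarith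
    have r2 : -1 < (-s + n).re := by simp; linarith
    have i1 := intervalIntegral.intervalIntegrable_cpow' (a := 0) (b := 1) r1
    have i2 := intervalIntegral.intervalIntegrable_cpow' (a := 0) (b := 1) r2
    refine ⟨?_, ?_⟩
    · exact ((intervalIntegrable_iff_integrableOn_Ioo_of_le zero_le_one).1 (i1.sub i2))
    · rw [← integral_Ioc_eq_integral_Ioo, ← intervalIntegral.integral_of_le zero_le_one,
        intervalIntegral.integral_sub i1 i2, integral_cpow (Or.inl r1), integral_cpow (Or.inl r2)]
      have z1 : s - 1 + n + 1 ≠ 0 := hne _ (by simp; linarith)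
      have z2 : -s + n + 1 ≠ 0 := hne _ (by simp; linarith)
      simp only [Complex.ofReal_one, Complex.one_cpow, Complex.ofReal_zero,
        Complex.zero_cpow z1, Complex.zero_cpow z2, sub_zero]
      congr 2 <;> ring
  have e1 : ∫ u in Ioo (0 : ℝ) 1, reflKernel s u * (1 - (u : ℂ) ^ N)
      = ∫ u in Ioo (0 : ℝ) 1,
        ∑ n ∈ Finset.range N, ((u : ℂ) ^ (s - 1 + n) - (u : ℂ) ^ (-s + n)) := by
    refine setIntegral_congr_fun measurableSet_Ioo fun u hu => ?_
    have hu0 : (u : ℂ) ≠ 0 := by exact_mod_cast hu.1.ne'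
    have hu1 : (1 - u : ℂ) ≠ 0 := by
      rw [sub_ne_zero]; exact_mod_cast hu.2.ne'
    simp only [reflKernel]
    have : ∀ n : ℕ, (u : ℂ) ^ (s - 1 + n) - (u : ℂ) ^ (-s + n)
        = ((u : ℂ) ^ (s - 1) - (u : ℂ) ^ (-s)) * (u : ℂ) ^ n := by
      intro n
      rw [Complex.cpow_add _ _ hu0, Complex.cpow_add _ _ hu0, Complex.cpow_natCast]; ring
    simp only [this]
    rw [← Finset.mul_sum, ← mul_neg_geom_sum]
    field_simp
  rw [e1, integral_finsetSum _ fun n _ => (step n).1]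
  simp only [fun n => (step n).2]
  clear e1
  induction N with
  | zero => simp
  | succ N ih =>
    have hsub : (1 : ℂ) / (N + 1 - s) = - (1 / (s - (N + 1))) := by
      rw [← neg_sub, div_neg]
    rw [Finset.sum_range_succ, Finset.sum_range_succ, ih, cotTerm, hsub]
    push_cast
    ring

/-- `∫_0^1 (u ^ (s - 1) - u ^ (-s)) / (1 - u) du = π cot (π s)`. Expanding `1 / (1 - u)` as a
geometric series gives the partial fractions of the cotangent. -/
theorem integral_reflKernel {s : ℂ} (h0 : 0 < s.re) (h1 : s.re < 1) :
    ∫ u in Ioo (0 : ℝ) 1, reflKernel s u = Real.pi * Complex.cot (Real.pi * s) := by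
  have hs : s ∈ Complex.integerComplement := mem_integerComplement h0 h1
  have A : Tendsto (fun N : ℕ => ∫ u in Ioo (0 : ℝ) 1, reflKernel s u * (1 - (u : ℂ) ^ N)) atTop
      (𝓝 (∫ u in Ioo (0 : ℝ) 1, reflKernel s u)) := by
    refine tendsto_integral_of_dominated_convergence (fun u => ‖reflKernel s u‖ * 2) ?_
      ((integrableOn_reflKernel h0 h1).norm.mul_const 2) ?_ ?_
    · intro N
      exact ((measurable_reflKernel s).mul (by fun_prop)).aestronglyMeasurable
    · intro N
      filter_upwards [ae_restrict_mem measurableSet_Ioo] with u hu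
      rw [norm_mul]
      refine mul_le_mul_of_nonneg_left ((norm_sub_le _ _).trans ?_) (norm_nonneg _)
      rw [norm_one, norm_pow, Complex.norm_real, Real.norm_of_nonneg hu.1.le]
      linarith [pow_le_one₀ (n := N) hu.1.le hu.2.le]
    · filter_upwards [ae_restrict_mem measurableSet_Ioo] with u hu
      have : Tendsto (fun N : ℕ => (u : ℂ) ^ N) atTop (𝓝 0) :=
        tendsto_pow_atTop_nhds_zero_of_norm_lt_one
          (by rw [Complex.norm_real, Real.norm_of_nonneg hu.1.le]; exact hu.2)
      simpa using (this.const_sub 1).const_mul (reflKernel s u)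
  have B : Tendsto (fun N : ℕ => ∫ u in Ioo (0 : ℝ) 1, reflKernel s u * (1 - (u : ℂ) ^ N)) atTop
      (𝓝 (Real.pi * Complex.cot (Real.pi * s))) := by
    simp only [integral_reflKernel_mul h0 h1]
    have C : Tendsto (fun N : ℕ => 1 / (s + N)) atTop (𝓝 0) := by
      simp only [one_div]
      refine tendsto_inv₀_cobounded.comp (tendsto_norm_atTop_iff_cobounded.1
        (tendsto_atTop_mono (fun N => le_trans (by simpa using h0.le) (Complex.re_le_norm _))
          (tendsto_natCast_atTop_atTop (R := ℝ))))
    have := ((tendsto_logDeriv_euler_cot_sub hs).const_add (1 / s)).sub C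
    simpa using this
  exact tendsto_nhds_unique A B

/-! ### The half-Hilbert transform of an inverse Mellin transform -/

theorem measurableSet_truncDomain (x ε : ℝ) : MeasurableSet (truncDomain x ε) :=
  measurableSet_Ioi.inter
    (measurableSet_lt measurable_const (measurable_id.sub_const x).abs)

theorem truncDomain_one {ε : ℝ} (h0 : 0 < ε) (h1 : ε < 1) :
    truncDomain 1 ε = Ioo 0 (1 - ε) ∪ Ioi (1 + ε) := by
  ext t
  simp only [truncDomain, mem_ofPred_eq, lt_abs, mem_union, mem_Ioo, mem_Ioi]
  constructor
  · rintro ⟨h, h' | h'⟩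
    · right; linarith
    · left; constructor <;> linarith
  · rintro (⟨h, h'⟩ | h)
    · exact ⟨h, Or.inr (by linarith)⟩
    · exact ⟨by linarith, Or.inl (by linarith)⟩

/-- Away from `x` the kernel is integrable: `0 < β` at infinity, `β < 1` at the origin. -/
theorem integrableOn_truncDomain_rpow {β x ε : ℝ} (h0 : 0 < β) (h1 : β < 1) (hx : 0 < x)
    (hε : 0 < ε) : IntegrableOn (fun t : ℝ => t ^ (-β) / |t - x|) (truncDomain x ε) := by
  have hm : Measurable fun t : ℝ => t ^ (-β) / |t - x| := by fun_prop
  have A : IntegrableOn (fun t : ℝ => t ^ (-β) / |t - x|) (truncDomain x ε ∩ Iic (2 * x)) := by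
    have hi : IntegrableOn (fun t : ℝ => t ^ (-β) * ε⁻¹) (Ioc 0 (2 * x)) :=
      ((intervalIntegrable_iff_integrableOn_Ioc_of_le (by linarith)).1
        (intervalIntegral.intervalIntegrable_rpow' (by linarith))).mul_const _
    refine (hi.mono_set fun t ht => ⟨ht.1.1, ht.2⟩).mono' hm.aestronglyMeasurable ?_
    filter_upwards [ae_restrict_mem ((measurableSet_truncDomain x ε).inter measurableSet_Iic)]
      with t ht
    have hp : 0 ≤ t ^ (-β) := Real.rpow_nonneg ht.1.1.le _
    rw [Real.norm_of_nonneg (by positivity), div_eq_mul_inv]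
    exact mul_le_mul_of_nonneg_left (inv_anti₀ hε ht.1.2.le) hp
  have B : IntegrableOn (fun t : ℝ => t ^ (-β) / |t - x|) (Ioi (2 * x)) := by
    have hi : IntegrableOn (fun t : ℝ => 2 * t ^ (-β - 1)) (Ioi (2 * x)) :=
      (integrableOn_Ioi_rpow_of_lt (by linarith) (by linarith)).const_mul _
    refine hi.mono' hm.aestronglyMeasurable ?_
    filter_upwards [ae_restrict_mem measurableSet_Ioi] with t ht
    have ht' : 2 * x < t := ht
    have ht0 : 0 < t := by linarith
    have hp : 0 ≤ t ^ (-β) := Real.rpow_nonneg ht0.le _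
    rw [Real.norm_of_nonneg (by positivity), abs_of_pos (by linarith), Real.rpow_sub_one ht0.ne',
      div_le_iff₀ (by linarith)]
    have : 2 * (t ^ (-β) / t) * (t - x) = t ^ (-β) * (2 * (t - x) / t) := by ring
    rw [this]
    refine le_mul_of_one_le_right hp ?_
    rw [le_div_iff₀ ht0]; linarith
  refine (A.union B).mono_set fun t ht => ?_
  rcases le_or_gt t (2 * x) with h | h
  · exact Or.inl ⟨ht, h⟩
  · exact Or.inr h

theorem norm_cpow_neg_div {s : ℂ} {x t : ℝ} (ht : 0 < t) :
    ‖(t : ℂ) ^ (-s) / ((t : ℂ) - x)‖ = t ^ (-s.re) / |t - x| := by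
  rw [norm_div, Complex.norm_cpow_eq_rpow_re_of_pos ht, ← Complex.ofReal_sub, Complex.norm_real,
    Real.norm_eq_abs, Complex.neg_re]

theorem integrableOn_truncDomain_cpow {s : ℂ} (h0 : 0 < s.re) (h1 : s.re < 1) {x ε : ℝ}
    (hx : 0 < x) (hε : 0 < ε) :
    IntegrableOn (fun t : ℝ => (t : ℂ) ^ (-s) / ((t : ℂ) - x)) (truncDomain x ε) := by
  refine (integrableOn_truncDomain_rpow h0 h1 hx hε).mono'
    (Measurable.aestronglyMeasurable (by fun_prop)) ?_
  filter_upwards [ae_restrict_mem (measurableSet_truncDomain x ε)] with t ht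
  exact (norm_cpow_neg_div ht.1).le

/-- The truncated integral of `u ^ (-s) / (u - 1)` around `u = 1`. -/
def truncKernel (s : ℂ) (ε : ℝ) : ℂ := ∫ u in truncDomain 1 ε, (u : ℂ) ^ (-s) / ((u : ℂ) - 1)

theorem intervalIntegrable_cpow_div {r : ℂ} (hr : -1 < r.re) {a b : ℝ} (ha : a < 1) (hb : b < 1) :
    IntervalIntegrable (fun u : ℝ => (u : ℂ) ^ r / (1 - u)) volume a b := by
  simp only [div_eq_mul_inv]
  refine (intervalIntegral.intervalIntegrable_cpow' hr).mul_continuousOn ?_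
  refine ContinuousOn.inv₀ (by fun_prop) fun u hu => ?_
  rw [sub_ne_zero]
  have : u < 1 := lt_of_le_of_lt hu.2 (max_lt ha hb)
  exact_mod_cast this.ne'

theorem integral_Ioi_cpow_div (s : ℂ) {c : ℝ} (hc : 1 < c) :
    ∫ u in Ioi c, (u : ℂ) ^ (-s) / ((u : ℂ) - 1)
      = ∫ u in (0 : ℝ)..c⁻¹, (u : ℂ) ^ (s - 1) / (1 - u) := by
  have hc0 : 0 < c := by linarith
  rw [intervalIntegral.integral_of_le (by positivity), integral_Ioc_eq_integral_Ioo,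
    ← inter_eq_right.2 (Ioi_subset_Ioi hc0.le), ← setIntegral_indicator measurableSet_Ioi,
    ← integral_comp_rpow_Ioi _ (show (-1 : ℝ) ≠ 0 by norm_num),
    show Ioo 0 c⁻¹ = Ioi (0 : ℝ) ∩ Iio c⁻¹ from rfl, ← setIntegral_indicator measurableSet_Iio]
  refine setIntegral_congr_fun measurableSet_Ioi fun u hu => ?_
  have hu : 0 < u := hu
  have hu0 : (u : ℂ) ≠ 0 := by exact_mod_cast hu.ne'
  simp only [Real.rpow_neg_one, indicator_apply, mem_Ioi, mem_Iio]
  by_cases h : u < c⁻¹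
  · have h' : c < u⁻¹ := (lt_inv_comm₀ hc0 hu).2 h
    have hu1 : u < 1 := h.trans (inv_lt_one_of_one_lt₀ hc)
    have hu2 : (1 - u : ℂ) ≠ 0 := by rw [sub_ne_zero]; exact_mod_cast hu1.ne'
    have hcp : ((u⁻¹ : ℝ) : ℂ) ^ (-s) = (u : ℂ) ^ s := by
      rw [Complex.ofReal_inv, Complex.inv_cpow _ _ (by
        rw [Complex.arg_ofReal_of_nonneg hu.le]; exact Real.pi_pos.ne), Complex.cpow_neg, inv_inv]
    have h3 : (u : ℂ)⁻¹ - 1 = (1 - u) / u := by field_simp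
    have h4 : u ^ (-1 - 1 : ℝ) = (u ^ 2)⁻¹ := by
      rw [show (-1 - 1 : ℝ) = -((2 : ℕ) : ℝ) by norm_num, Real.rpow_neg hu.le, Real.rpow_natCast]
    rw [if_pos h, if_pos h', hcp, abs_neg, abs_one, one_mul, Complex.real_smul, h4,
      Complex.cpow_sub _ _ hu0, Complex.cpow_one]
    push_cast
    rw [h3]
    field_simp
  · have h' : ¬ c < u⁻¹ := fun h' => h ((lt_inv_comm₀ hc0 hu).1 h')
    rw [if_neg h, if_neg h', smul_zero]

/-- The substitution `u ↦ 1 / u` on `u > 1` moves the truncated kernel to the interval `(0, 1)`;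
the truncations of the two halves differ by an interval of length `O(ε ^ 2)`. -/
theorem truncKernel_eq {s : ℂ} (h0 : 0 < s.re) (h1 : s.re < 1) {ε : ℝ} (hε : 0 < ε)
    (hε1 : ε < 1) : truncKernel s ε = (∫ u in (0 : ℝ)..(1 - ε), reflKernel s u)
      + ∫ u in (1 - ε)..(1 + ε)⁻¹, (u : ℂ) ^ (s - 1) / (1 - u) := by
  have hi := integrableOn_truncDomain_cpow h0 h1 one_pos hε
  have hinv : (1 + ε)⁻¹ < 1 := inv_lt_one_of_one_lt₀ (by linarith)
  rw [truncKernel]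
  rw [truncDomain_one hε hε1] at hi ⊢
  simp only [Complex.ofReal_one] at hi
  rw [setIntegral_union (by
      rw [Set.disjoint_left]; rintro t ht (ht' : 1 + ε < t); have := ht.2; linarith)
    measurableSet_Ioi (hi.mono_set subset_union_left) (hi.mono_set subset_union_right),
    integral_Ioi_cpow_div s (by linarith), ← integral_Ioc_eq_integral_Ioo,
    ← intervalIntegral.integral_of_le (by linarith)]
  have r1 : -1 < (s - 1).re := by simpa using h0
  have r2 : -1 < (-s).re := by simpa using h1
  have i1 := intervalIntegrable_cpow_div r1 (a := 0) (b := 1 - ε) (by norm_num) (by linarith)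
  have i2 := intervalIntegrable_cpow_div r1 (a := 1 - ε) (by linarith) hinv
  have i3 := intervalIntegrable_cpow_div r2 (a := 0) (b := 1 - ε) (by norm_num) (by linarith)
  rw [← intervalIntegral.integral_add_adjacent_intervals i1 i2, ← add_assoc]
  congr 1
  have : ∀ u : ℝ, reflKernel s u = (u : ℂ) ^ (s - 1) / (1 - u) - (u : ℂ) ^ (-s) / (1 - u) :=
    fun u => sub_div _ _ _
  simp only [this]
  rw [intervalIntegral.integral_sub i1 i3, sub_eq_neg_add (∫ u in (0 : ℝ)..(1 - ε), _),
    ← intervalIntegral.integral_neg]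
  congr 2
  funext u
  rw [← div_neg, neg_sub]

theorem norm_integral_remainder_le {s : ℂ} (h0 : 0 < s.re) (h1 : s.re < 1) {ε : ℝ} (hε : 0 < ε)
    (hε1 : ε ≤ 1 / 2) :
    ‖∫ u in (1 - ε)..(1 + ε)⁻¹, (u : ℂ) ^ (s - 1) / (1 - u)‖ ≤ 2 * ε := by
  have hdiff : (1 + ε)⁻¹ - (1 - ε) = ε ^ 2 / (1 + ε) := by field_simp; ring
  have hle : 1 - ε ≤ (1 + ε)⁻¹ := by
    have : 0 ≤ ε ^ 2 / (1 + ε) := by positivity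
    linarith
  have hb : ∀ u ∈ uIoc (1 - ε) (1 + ε)⁻¹,
      ‖(u : ℂ) ^ (s - 1) / (1 - u)‖ ≤ 2 * ((1 + ε) / ε) := by
    intro u hu
    rw [uIoc_of_le hle] at hu
    have hu2 : 1 / 2 ≤ u := by linarith [hu.1]
    have hu0 : 0 < u := by linarith
    have hd : ε / (1 + ε) ≤ 1 - u := by
      have : 1 - (1 + ε)⁻¹ = ε / (1 + ε) := by field_simp; ring
      linarith [hu.2]
    have hd0 : 0 < ε / (1 + ε) := by positivity
    have hn : ‖(1 - u : ℂ)‖ = 1 - u := by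
      rw [← Complex.ofReal_one, ← Complex.ofReal_sub, Complex.norm_real,
        Real.norm_of_nonneg (by linarith)]
    rw [norm_div, hn, Complex.norm_cpow_eq_rpow_re_of_pos hu0, div_eq_mul_inv]
    have e1 : u ^ (s - 1).re ≤ 2 := by
      have : (s - 1).re = -(1 - s.re) := by simp
      rw [this, Real.rpow_neg hu0.le, ← Real.inv_rpow hu0.le]
      calc (u⁻¹) ^ (1 - s.re) ≤ 2 ^ (1 - s.re) := Real.rpow_le_rpow (by positivity)
            (by rw [inv_le_comm₀ hu0 (by norm_num)]; linarith) (by linarith)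
        _ ≤ 2 ^ (1 : ℝ) := Real.rpow_le_rpow_of_exponent_le (by norm_num) (by linarith)
        _ = 2 := Real.rpow_one 2
    have e2 : (1 - u)⁻¹ ≤ (1 + ε) / ε := by
      rw [← inv_div]; exact inv_anti₀ hd0 hd
    exact mul_le_mul e1 e2 (inv_nonneg.2 (by linarith)) (by norm_num)
  refine (intervalIntegral.norm_integral_le_of_norm_le_const hb).trans ?_
  rw [abs_of_nonneg (by linarith), hdiff]
  apply le_of_eq
  field_simp

theorem tendsto_truncKernel {s : ℂ} (h0 : 0 < s.re) (h1 : s.re < 1) :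
    Tendsto (truncKernel s) (𝓝[>] 0) (𝓝 (Real.pi * Complex.cot (Real.pi * s))) := by
  have A : Tendsto (fun ε : ℝ => ∫ u in (0 : ℝ)..(1 - ε), reflKernel s u) (𝓝[>] 0)
      (𝓝 (Real.pi * Complex.cot (Real.pi * s))) := by
    have hc := intervalIntegral.continuousOn_primitive_interval
      (f := reflKernel s) (a := 0) (b := 1) (μ := volume) (by
        rw [uIcc_of_le zero_le_one, integrableOn_Icc_iff_integrableOn_Ioo]
        exact integrableOn_reflKernel h0 h1)
    have h := hc 1 right_mem_uIcc
    simp only [ContinuousWithinAt] at h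
    rw [intervalIntegral.integral_of_le zero_le_one, integral_Ioc_eq_integral_Ioo,
      integral_reflKernel h0 h1] at h
    refine h.comp (tendsto_nhdsWithin_iff.2 ⟨?_, ?_⟩)
    · have : Tendsto (fun ε : ℝ => 1 - ε) (𝓝 0) (𝓝 (1 - 0)) :=
        (continuous_const.sub continuous_id).tendsto 0
      rw [sub_zero] at this
      exact this.mono_left nhdsWithin_le_nhds
    · filter_upwards [Ioo_mem_nhdsGT (zero_lt_one' ℝ)] with ε hε
      rw [uIcc_of_le zero_le_one]
      exact ⟨by linarith [hε.2], by linarith [hε.1]⟩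
  have B : Tendsto (fun ε : ℝ => ∫ u in (1 - ε)..(1 + ε)⁻¹, (u : ℂ) ^ (s - 1) / (1 - u)) (𝓝[>] 0)
      (𝓝 0) := by
    refine squeeze_zero_norm' (a := fun ε => 2 * ε) ?_ ?_
    · filter_upwards [Ioo_mem_nhdsGT (show (0 : ℝ) < 1 / 2 by norm_num)] with ε hε
      exact norm_integral_remainder_le h0 h1 hε.1 hε.2.le
    · have : Tendsto (fun ε : ℝ => 2 * ε) (𝓝 0) (𝓝 (2 * 0)) :=
        (continuous_const.mul continuous_id).tendsto 0
      rw [mul_zero] at this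
      exact this.mono_left nhdsWithin_le_nhds
  have C := A.add B
  rw [add_zero] at C
  refine C.congr' ?_
  filter_upwards [Ioo_mem_nhdsGT (zero_lt_one' ℝ)] with ε hε
  exact (truncKernel_eq h0 h1 hε.1 hε.2).symm

/-- The truncated kernel is bounded uniformly in the truncation, by the weight of `Im s`. -/
theorem norm_truncKernel_le {s : ℂ} (h0 : 0 < s.re) (h1 : s.re < 1) {ε : ℝ} (hε : 0 < ε)
    (hε1 : ε ≤ 1 / 2) :
    ‖truncKernel s ε‖ ≤ ((∫ u in Ioc (0 : ℝ) 1, kernelBound s.re u) + 1) * wt s.im := by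
  rw [truncKernel_eq h0 h1 hε (by linarith)]
  have A : ‖∫ u in (0 : ℝ)..(1 - ε), reflKernel s u‖
      ≤ (∫ u in Ioc (0 : ℝ) 1, kernelBound s.re u) * wt s.im := by
    have hi : IntegrableOn (fun u => wt s.im * kernelBound s.re u) (Ioc 0 1) :=
      (integrableOn_kernelBound h0 h1).const_mul (wt s.im)
    have hsub : Ioc 0 (1 - ε) ⊆ Ioc (0 : ℝ) 1 := Ioc_subset_Ioc_right (by linarith)
    rw [intervalIntegral.integral_of_le (by linarith), mul_comm, ← integral_const_mul]
    refine (norm_integral_le_of_norm_le (hi.mono_set hsub) ?_).trans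
      (setIntegral_mono_set hi ?_ hsub.eventuallyLE)
    · filter_upwards [ae_restrict_mem measurableSet_Ioc] with u hu
      exact norm_reflKernel_le h0 h1 ⟨hu.1, by linarith [hu.2]⟩
    · filter_upwards [ae_restrict_mem measurableSet_Ioc] with u hu
      have hp1 : 0 ≤ u ^ (s.re - 1) := Real.rpow_nonneg hu.1.le _
      have hp2 : 0 ≤ u ^ (-s.re) := Real.rpow_nonneg hu.1.le _
      have hw := wt_pos s.im
      simp only [Pi.zero_apply, kernelBound]
      positivity
  have B := norm_integral_remainder_le h0 h1 hε hε1
  have := one_le_wt s.im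
  refine (norm_add_le _ _).trans ?_
  linarith

/-- The inverse Mellin transform on the line `Re s = β`, as a function of the values `p τ` of the
transform at `β + iτ`. -/
def invLine (β : ℝ) (p : ℝ → ℂ) (t : ℝ) : ℂ :=
  1 / (2 * Real.pi) * ∫ τ : ℝ, p τ * (t : ℂ) ^ (-(vpt β τ))

theorem mellinInversion_eq_invLine (β : ℝ) (F : ℂ → ℂ) (x : ℝ) :
    mellinInversion β F x = invLine β (fun τ => F (vpt β τ)) x := by
  rw [mellinInversion, vintegral, invLine, ← mul_assoc]
  congr 1
  have := Complex.I_ne_zero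
  field_simp

/-- Integrability of `(1 + |τ|)^{1/4} p(τ)`. -/
def WeightedL1 (p : ℝ → ℂ) : Prop := Integrable fun τ => (wt τ : ℂ) * p τ

theorem integral_truncDomain_cpow (s : ℂ) {x : ℝ} (hx : 0 < x) (ε : ℝ) :
    ∫ t in truncDomain x ε, (t : ℂ) ^ (-s) / ((t : ℂ) - x)
      = (x : ℂ) ^ (-s) * truncKernel s (ε / x) := by
  have hx0 : (x : ℂ) ≠ 0 := by exact_mod_cast hx.ne'
  rw [truncKernel, ← integral_indicator (measurableSet_truncDomain _ _),
    ← integral_indicator (measurableSet_truncDomain _ _), ← integral_const_mul]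
  have h := Measure.integral_comp_mul_left
    ((truncDomain x ε).indicator fun t : ℝ => (t : ℂ) ^ (-s) / ((t : ℂ) - x)) x
  have h2 : ∀ I : ℂ, I = (x : ℂ) * (|x⁻¹| • I) := by
    intro I
    rw [abs_of_pos (by positivity), Complex.real_smul]
    push_cast
    field_simp
  rw [h2 (∫ t, _), ← h, ← integral_const_mul]
  congr 1
  funext u
  have hmem : x * u ∈ truncDomain x ε ↔ u ∈ truncDomain 1 (ε / x) := by
    simp only [truncDomain, mem_ofPred_eq]
    rw [mul_pos_iff_of_pos_left hx, div_lt_iff₀ hx,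
      show x * u - x = (u - 1) * x by ring, abs_mul, abs_of_pos hx]
  by_cases hu : u ∈ truncDomain 1 (ε / x)
  · rw [indicator_of_mem hu, indicator_of_mem (hmem.2 hu)]
    push_cast
    rw [Complex.mul_cpow_ofReal_nonneg hx.le hu.1.le,
      show (x : ℂ) * u - x = x * (u - 1) by ring]
    field_simp
  · rw [indicator_of_notMem hu, indicator_of_notMem (fun h => hu (hmem.1 h))]
    simp

theorem WeightedL1.integrable {p : ℝ → ℂ} (hp : WeightedL1 p) : Integrable p := by
  have h1 : ∀ τ, (wt τ : ℂ) ≠ 0 := fun τ => by exact_mod_cast (wt_pos τ).ne'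
  have : p = fun τ => ((wt τ : ℂ))⁻¹ * ((wt τ : ℂ) * p τ) := by
    funext τ
    rw [inv_mul_cancel_left₀ (h1 τ)]
  rw [this]
  refine hp.bdd_mul (c := 1) ?_ (Eventually.of_forall fun τ => ?_)
  · exact (Complex.continuous_ofReal.comp continuous_wt).inv₀ h1 |>.aestronglyMeasurable
  · rw [norm_inv, Complex.norm_real, Real.norm_of_nonneg (wt_pos τ).le]
    exact inv_le_one_of_one_le₀ (one_le_wt τ)

theorem measurable_cpow_vpt (β : ℝ) :
    Measurable fun z : ℝ × ℝ => (z.2 : ℂ) ^ (-(vpt β z.1)) := by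
  have := (continuous_vpt β).measurable
  fun_prop

theorem integrable_invLine_div {β : ℝ} (h0 : 0 < β) (h1 : β < 1) {p : ℝ → ℂ} (hp : Integrable p)
    {x ε : ℝ} (hx : 0 < x) (hε : 0 < ε) :
    Integrable (fun z : ℝ × ℝ => p z.1 * (z.2 : ℂ) ^ (-(vpt β z.1)) / ((z.2 : ℂ) - x))
      (volume.prod (volume.restrict (truncDomain x ε))) := by
  refine (hp.norm.mul_prod (integrableOn_truncDomain_rpow h0 h1 hx hε)).mono' ?_ ?_
  · have := hp.aestronglyMeasurable.comp_fst (ν := volume.restrict (truncDomain x ε))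
    simp only [div_eq_mul_inv]
    refine (this.mul (measurable_cpow_vpt β).aestronglyMeasurable).mul ?_
    exact Measurable.aestronglyMeasurable (by fun_prop)
  · have : ∀ᵐ z ∂((volume : Measure ℝ).prod (volume.restrict (truncDomain x ε))),
        z.2 ∈ truncDomain x ε :=
      Measure.quasiMeasurePreserving_snd.ae (ae_restrict_mem (measurableSet_truncDomain x ε))
    filter_upwards [this] with z hz
    rw [mul_div_assoc, norm_mul, norm_cpow_neg_div hz.1, vpt_re]

theorem integrableOn_invLine_div {β : ℝ} (h0 : 0 < β) (h1 : β < 1) {p : ℝ → ℂ} (hp : Integrable p)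
    {x ε : ℝ} (hx : 0 < x) (hε : 0 < ε) :
    IntegrableOn (fun t : ℝ => invLine β p t / ((t : ℂ) - x)) (truncDomain x ε) := by
  have h := ((integrable_invLine_div h0 h1 hp hx hε).integral_prod_right).const_mul
    (1 / (2 * Real.pi : ℂ))
  refine h.congr (Eventually.of_forall fun t => ?_)
  simp only [invLine, integral_div]
  ring

theorem truncHilbert_invLine {β : ℝ} (h0 : 0 < β) (h1 : β < 1) {p : ℝ → ℂ} (hp : Integrable p)
    {x ε : ℝ} (hx : 0 < x) (hε : 0 < ε) :
    truncHilbert (invLine β p) x ε = 1 / (Real.pi : ℂ) * (1 / (2 * Real.pi) *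
      ∫ τ : ℝ, p τ * (x : ℂ) ^ (-(vpt β τ)) * truncKernel (vpt β τ) (ε / x)) := by
  rw [truncHilbert]
  congr 1
  have e1 : ∀ t : ℝ, invLine β p t / ((t : ℂ) - x) = 1 / (2 * Real.pi) *
      ∫ τ : ℝ, p τ * (t : ℂ) ^ (-(vpt β τ)) / ((t : ℂ) - x) := by
    intro t
    rw [invLine, integral_div]; ring
  simp only [e1]
  rw [integral_const_mul]
  congr 1
  rw [← integral_integral_swap (f := fun (τ t : ℝ) => p τ * (t : ℂ) ^ (-(vpt β τ)) / ((t : ℂ) - x))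
    (integrable_invLine_div h0 h1 hp hx hε)]
  congr 1
  funext τ
  simp only [mul_div_assoc]
  rw [integral_const_mul, integral_truncDomain_cpow _ hx, mul_assoc]

theorem truncHilbert_congr {f g : ℝ → ℂ} (h : ∀ᵐ t ∂(volume.restrict (Ioi (0 : ℝ))), f t = g t)
    (x ε : ℝ) : truncHilbert f x ε = truncHilbert g x ε := by
  rw [truncHilbert, truncHilbert]
  congr 1
  refine integral_congr_ae ?_
  filter_upwards [ae_restrict_of_ae_restrict_of_subset (fun t ht => ht.1) h] with t ht
  rw [ht]

/-- The half-Hilbert transform acts on the Mellin side as the multiplication by `cot (π s)`. -/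
theorem halfHilbert_invLine {β : ℝ} (h0 : 0 < β) (h1 : β < 1) {p : ℝ → ℂ} (hp : WeightedL1 p)
    {f : ℝ → ℂ} (hf : ∀ᵐ t ∂(volume.restrict (Ioi (0 : ℝ))), f t = invLine β p t)
    {x : ℝ} (hx : 0 < x) :
    HalfHilbertExists f x ∧
      halfHilbert f x = invLine β (fun τ => Complex.cot (Real.pi * vpt β τ) * p τ) x := by
  have hlim : Tendsto (truncHilbert f x) (𝓝[>] 0)
      (𝓝 (invLine β (fun τ => Complex.cot (Real.pi * vpt β τ) * p τ) x)) := by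
    have A : Tendsto (fun ε => ∫ τ : ℝ, p τ * (x : ℂ) ^ (-(vpt β τ)) *
        truncKernel (vpt β τ) (ε / x)) (𝓝[>] 0) (𝓝 (∫ τ : ℝ, p τ * (x : ℂ) ^ (-(vpt β τ)) *
          (Real.pi * Complex.cot (Real.pi * vpt β τ)))) := by
      -- the truncated kernels are dominated, uniformly in `ε`, by the weight of `p`
      set C := (∫ u in Ioc (0 : ℝ) 1, kernelBound β u) + 1
      refine tendsto_integral_filter_of_dominated_convergence
        (fun τ => x ^ (-β) * C * ‖(wt τ : ℂ) * p τ‖) ?_ ?_ (hp.norm.const_mul _) ?_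
      · filter_upwards [self_mem_nhdsWithin] with ε hε
        have i := (integrable_invLine_div h0 h1 hp.integrable hx hε).integral_prod_left
        refine i.aestronglyMeasurable.congr (Eventually.of_forall fun τ => ?_)
        simp only [mul_div_assoc]
        rw [integral_const_mul, integral_truncDomain_cpow _ hx, mul_assoc]
      · filter_upwards [Ioo_mem_nhdsGT (show (0 : ℝ) < x / 2 by positivity)] with ε hε
        refine Eventually.of_forall fun τ => ?_
        have hb := norm_truncKernel_le (s := vpt β τ) (by simpa using h0) (by simpa using h1)
          (div_pos hε.1 hx) (by rw [div_le_iff₀ hx]; linarith [hε.2])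
        rw [vpt_re, vpt_im] at hb
        rw [norm_mul, norm_mul, Complex.norm_cpow_eq_rpow_re_of_pos hx, norm_mul,
          Complex.norm_real, Real.norm_of_nonneg (wt_pos τ).le, Complex.neg_re, vpt_re]
        have := mul_le_mul_of_nonneg_left hb
          (mul_nonneg (norm_nonneg (p τ)) (Real.rpow_nonneg hx.le (-β)))
        refine this.trans (le_of_eq ?_)
        ring
      · refine Eventually.of_forall fun τ => Tendsto.const_mul _ ?_
        refine (tendsto_truncKernel (s := vpt β τ) (by simpa using h0) (by simpa using h1)).comp ?_
        refine tendsto_nhdsWithin_iff.2 ⟨?_, ?_⟩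
        · have : Tendsto (fun ε : ℝ => ε / x) (𝓝 0) (𝓝 (0 / x)) :=
            (continuous_id.div_const x).tendsto 0
          rw [zero_div] at this
          exact this.mono_left nhdsWithin_le_nhds
        · filter_upwards [self_mem_nhdsWithin] with ε hε
          exact div_pos hε hx
    have B := (A.const_mul (1 / (2 * Real.pi) : ℂ)).const_mul (1 / (Real.pi : ℂ))
    have e : invLine β (fun τ => Complex.cot (Real.pi * vpt β τ) * p τ) x
        = 1 / (Real.pi : ℂ) * (1 / (2 * Real.pi) * ∫ τ : ℝ, p τ * (x : ℂ) ^ (-(vpt β τ)) *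
          (Real.pi * Complex.cot (Real.pi * vpt β τ))) := by
      have hpi : (Real.pi : ℂ) ≠ 0 := by exact_mod_cast Real.pi_ne_zero
      rw [invLine, mul_left_comm (1 / (Real.pi : ℂ))]
      congr 1
      rw [← integral_const_mul]
      congr 1
      funext τ
      field_simp
    rw [e]
    refine B.congr' ?_
    filter_upwards [self_mem_nhdsWithin] with ε hε
    rw [truncHilbert_congr hf, truncHilbert_invLine h0 h1 hp.integrable hx hε]
  have heq : halfHilbert f x = _ := hlim.limUnder_eq
  refine ⟨⟨fun ε hε => ?_, heq ▸ hlim⟩, heq⟩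
  refine (integrableOn_invLine_div h0 h1 hp.integrable hx hε).congr ?_
  filter_upwards [ae_restrict_of_ae_restrict_of_subset (fun t ht => ht.1) hf] with t ht
  rw [ht]

/-! ### Mellin transforms and Plancherel's theorem -/

open FourierTransform SchwartzMap in
/-- On `L¹ ∩ L²` the Fourier transform of `L²` is given by the Fourier integral. -/
theorem coe_fourier_toLp {p : ℝ → ℂ} (h1 : Integrable p) (h2 : MemLp p 2) :
    (𝓕 (h2.toLp p) : Lp ℂ 2 (volume : Measure ℝ)) =ᵐ[volume] 𝓕 p := by
  have hc : Continuous (𝓕 p) := VectorFourier.fourierIntegral_continuous Real.continuous_fourierChar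
    continuous_inner h1
  refine ae_eq_of_integral_contDiff_smul_eq ((Lp.memLp _).locallyIntegrable (by norm_num))
    hc.locallyIntegrable fun g hg hgc => ?_
  have hg₁ : HasCompactSupport (Complex.ofRealCLM ∘ g) := hgc.comp_left rfl
  have hg₂ : ContDiff ℝ (⊤ : ℕ∞) (Complex.ofRealCLM ∘ g) := by fun_prop
  set φ : 𝓢(ℝ, ℂ) := hg₁.toSchwartzMap hg₂ with hφ
  have e1 : ∀ q : ℝ → ℂ, ∫ x, g x • q x = ∫ x, φ x • q x := fun q => by simp [hφ]
  rw [e1, e1, ← Lp.toTemperedDistribution_apply, ← Lp.fourier_toTemperedDistribution_eq,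
    TemperedDistribution.fourier_apply, Lp.toTemperedDistribution_apply]
  have e2 := VectorFourier.integral_fourierIntegral_smul_eq_flip (L := innerₗ ℝ)
    Real.continuous_fourierChar continuous_inner (φ.integrable (μ := volume)) h1
  rw [flip_innerₗ] at e2
  refine Eq.trans (integral_congr_ae ?_) e2
  filter_upwards [h2.coeFn_toLp] with x hx
  rw [hx]
  rfl

open FourierTransform SchwartzMap in
theorem coe_fourierInv_toLp {p : ℝ → ℂ} (h1 : Integrable p) (h2 : MemLp p 2) :
    (𝓕⁻ (h2.toLp p) : Lp ℂ 2 (volume : Measure ℝ)) =ᵐ[volume] 𝓕⁻ p := by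
  have hL : Continuous fun z : ℝ × ℝ => (-innerₗ ℝ) z.1 z.2 := continuous_inner.neg
  have hc : Continuous (𝓕⁻ p) := VectorFourier.fourierIntegral_continuous
    Real.continuous_fourierChar hL h1
  refine ae_eq_of_integral_contDiff_smul_eq ((Lp.memLp _).locallyIntegrable (by norm_num))
    hc.locallyIntegrable fun g hg hgc => ?_
  have hg₁ : HasCompactSupport (Complex.ofRealCLM ∘ g) := hgc.comp_left rfl
  have hg₂ : ContDiff ℝ (⊤ : ℕ∞) (Complex.ofRealCLM ∘ g) := by fun_prop
  set φ : 𝓢(ℝ, ℂ) := hg₁.toSchwartzMap hg₂ with hφ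
  have e1 : ∀ q : ℝ → ℂ, ∫ x, g x • q x = ∫ x, φ x • q x := fun q => by simp [hφ]
  rw [e1, e1, ← Lp.toTemperedDistribution_apply, ← Lp.fourierInv_toTemperedDistribution_eq,
    TemperedDistribution.fourierInv_apply, Lp.toTemperedDistribution_apply]
  have e2 := VectorFourier.integral_fourierIntegral_smul_eq_flip (L := -innerₗ ℝ)
    Real.continuous_fourierChar hL (φ.integrable (μ := volume)) h1
  have e3 : (-innerₗ ℝ : ℝ →ₗ[ℝ] ℝ →ₗ[ℝ] ℝ).flip = -innerₗ ℝ := by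
    ext; simp
  rw [e3] at e2
  refine Eq.trans (integral_congr_ae ?_) e2
  filter_upwards [h2.coeFn_toLp] with x hx
  rw [hx, fourierInv_coe]
  rfl

/-- The exponential parametrization `ξ ↦ e ^ (2πξ)` of the half-line. -/
def expParam (ξ : ℝ) : ℝ := Real.exp (2 * Real.pi * ξ)

theorem expParam_pos (ξ : ℝ) : 0 < expParam ξ := Real.exp_pos _

theorem continuous_expParam : Continuous expParam := by unfold expParam; fun_prop

theorem hasDerivAt_expParam (ξ : ℝ) : HasDerivAt expParam (2 * Real.pi * expParam ξ) ξ := by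
  have := ((hasDerivAt_id ξ).const_mul (2 * Real.pi)).exp
  simp only [id_eq, mul_one] at this
  exact this.congr_deriv (mul_comm _ _)

theorem injective_expParam : Function.Injective expParam := by
  intro a b h
  have := Real.exp_injective h
  exact mul_left_cancel₀ Real.two_pi_pos.ne' this

theorem expParam_log {t : ℝ} (ht : 0 < t) : expParam (Real.log t / (2 * Real.pi)) = t := by
  rw [expParam, mul_div_cancel₀ _ Real.two_pi_pos.ne', Real.exp_log ht]

theorem log_expParam (ξ : ℝ) : Real.log (expParam ξ) / (2 * Real.pi) = ξ := by
  rw [expParam, Real.log_exp, mul_div_cancel_left₀ _ Real.two_pi_pos.ne']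

theorem image_expParam : expParam '' univ = Ioi 0 := by
  rw [image_univ]
  ext t
  exact ⟨fun ⟨ξ, h⟩ => h ▸ expParam_pos ξ, fun h => ⟨_, expParam_log h⟩⟩

theorem integral_Ioi_expParam (h : ℝ → ℂ) :
    ∫ t in Ioi (0 : ℝ), h t = ∫ ξ, (2 * Real.pi * expParam ξ) • h (expParam ξ) := by
  rw [← image_expParam, integral_image_eq_integral_abs_deriv_smul MeasurableSet.univ
    (fun x _ => (hasDerivAt_expParam x).hasDerivWithinAt) injective_expParam.injOn, setIntegral_univ]
  congr 1
  funext ξ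
  rw [abs_of_pos (mul_pos Real.two_pi_pos (expParam_pos ξ))]

theorem integrableOn_Ioi_expParam (h : ℝ → ℝ) :
    IntegrableOn h (Ioi 0) ↔ Integrable fun ξ => 2 * Real.pi * expParam ξ * h (expParam ξ) := by
  rw [← image_expParam, integrableOn_image_iff_integrableOn_abs_deriv_smul MeasurableSet.univ
    (fun x _ => (hasDerivAt_expParam x).hasDerivWithinAt) injective_expParam.injOn, integrableOn_univ]
  refine integrable_congr (Eventually.of_forall fun ξ => ?_)
  simp only [smul_eq_mul]
  rw [abs_of_pos (mul_pos Real.two_pi_pos (expParam_pos ξ))]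

/-- The parametrization and its inverse are differentiable, so they preserve null sets. -/
theorem ae_expParam_iff {P : ℝ → Prop} :
    (∀ᵐ ξ : ℝ, P (expParam ξ)) ↔ ∀ᵐ t ∂(volume.restrict (Ioi (0 : ℝ))), P t := by
  rw [ae_restrict_iff' measurableSet_Ioi, ae_iff, ae_iff]
  constructor
  · intro h
    have h' := addHaar_image_eq_zero_of_differentiableOn_of_addHaar_eq_zero volume
      (f := expParam) (fun x _ => (hasDerivAt_expParam x).differentiableAt.differentiableWithinAt) h
    refine measure_mono_null ?_ h'
    intro t ht
    simp only [mem_ofPred_eq, Classical.not_imp] at ht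
    exact ⟨Real.log t / (2 * Real.pi), by simpa [expParam_log ht.1] using ht.2, expParam_log ht.1⟩
  · intro h
    have h' := addHaar_image_eq_zero_of_differentiableOn_of_addHaar_eq_zero volume
      (f := fun t => Real.log t / (2 * Real.pi)) (fun x hx => by
        simp only [mem_ofPred_eq, Classical.not_imp] at hx
        have hx0 : x ≠ 0 := (show (0 : ℝ) < x from hx.1).ne'
        exact ((Real.differentiableAt_log hx0).div_const _).differentiableWithinAt) h
    refine measure_mono_null ?_ h'
    intro ξ hξ
    refine ⟨expParam ξ, ?_, log_expParam ξ⟩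
    simp only [mem_ofPred_eq, Classical.not_imp]
    exact ⟨expParam_pos ξ, hξ⟩

theorem quasiMeasurePreserving_expParam :
    Measure.QuasiMeasurePreserving expParam volume (volume.restrict (Ioi 0)) := by
  refine ⟨continuous_expParam.measurable, Measure.AbsolutelyContinuous.mk fun s hs h => ?_⟩
  rw [Measure.map_apply continuous_expParam.measurable hs]
  rw [measure_eq_zero_iff_ae_notMem] at h ⊢
  exact ae_expParam_iff.2 h

theorem quasiMeasurePreserving_log :
    Measure.QuasiMeasurePreserving (fun t => Real.log t / (2 * Real.pi))
      (volume.restrict (Ioi 0)) volume := by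
  have hm : Measurable fun t => Real.log t / (2 * Real.pi) := by fun_prop
  refine ⟨hm, Measure.AbsolutelyContinuous.mk fun s hs h => ?_⟩
  rw [Measure.map_apply hm hs]
  rw [measure_eq_zero_iff_ae_notMem] at h ⊢
  refine ae_expParam_iff.1 ?_
  filter_upwards [h] with ξ hξ
  rwa [mem_preimage, log_expParam]

/-- The function on the line whose inverse Fourier transform is the Mellin transform of `f` on
`Re s = β`. -/
def logPullback (β : ℝ) (f : ℝ → ℂ) (ξ : ℝ) : ℂ :=
  ((2 * Real.pi * expParam ξ ^ β : ℝ) : ℂ) * f (expParam ξ)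

theorem continuous_expParam_rpow (β : ℝ) : Continuous fun ξ => 2 * Real.pi * expParam ξ ^ β :=
  continuous_const.mul (continuous_expParam.rpow_const fun ξ => Or.inl (expParam_pos ξ).ne')

theorem aestronglyMeasurable_restrict_of_weightMeasure {β : ℝ} {f : ℝ → ℂ}
    (h : AEStronglyMeasurable f (weightMeasure β)) :
    AEStronglyMeasurable f (volume.restrict (Ioi 0)) := by
  have hm : Measurable fun x : ℝ => ENNReal.ofReal (x ^ (2 * β - 1)) := by fun_prop
  refine h.mono_ac (withDensity_absolutelyContinuous' hm.aemeasurable ?_)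
  filter_upwards [ae_restrict_mem measurableSet_Ioi] with x hx
  simpa using Real.rpow_pos_of_pos hx _

theorem aestronglyMeasurable_weightMeasure_iff (β : ℝ) (f : ℝ → ℂ) :
    AEStronglyMeasurable f (weightMeasure β) ↔ AEStronglyMeasurable (logPullback β f) volume := by
  have hc := continuous_expParam_rpow β
  constructor
  · intro h
    have h2 := aestronglyMeasurable_restrict_of_weightMeasure h
    exact (Complex.continuous_ofReal.comp hc).aestronglyMeasurable.mul
      (h2.comp_quasiMeasurePreserving quasiMeasurePreserving_expParam)
  · intro h
    refine AEStronglyMeasurable.mono_ac (withDensity_absolutelyContinuous _ _) ?_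
    have h2 : AEStronglyMeasurable (fun ξ => f (expParam ξ)) volume := by
      refine ((Complex.continuous_ofReal.comp (hc.inv₀ fun ξ => ?_)).aestronglyMeasurable.mul
        h).congr (Eventually.of_forall fun ξ => ?_)
      · have := Real.rpow_pos_of_pos (expParam_pos ξ) β
        have := Real.pi_pos
        positivity
      · have := Real.rpow_pos_of_pos (expParam_pos ξ) β
        have h3 : (2 * Real.pi * expParam ξ ^ β : ℝ) ≠ 0 := by
          have := Real.pi_pos
          positivity
        simp only [Pi.mul_apply, Function.comp_apply, logPullback, Pi.inv_apply]
        rw [Complex.ofReal_inv, inv_mul_cancel_left₀ (by exact_mod_cast h3)]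
    refine (h2.comp_quasiMeasurePreserving quasiMeasurePreserving_log).congr ?_
    filter_upwards [ae_restrict_mem measurableSet_Ioi] with t ht
    simp only [Function.comp_apply, expParam_log ht]

theorem memLp_weightMeasure_iff (β : ℝ) (f : ℝ → ℂ) :
    MemLp f 2 (weightMeasure β) ↔ MemLp (logPullback β f) 2 := by
  have hm : Measurable fun x : ℝ => ENNReal.ofReal (x ^ (2 * β - 1)) := by fun_prop
  have key : Integrable (fun x => ‖f x‖ ^ 2) (weightMeasure β)
      ↔ Integrable fun ξ => ‖logPullback β f ξ‖ ^ 2 := by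
    rw [weightMeasure, integrable_withDensity_iff_integrable_smul' hm
      (Eventually.of_forall fun x => ENNReal.ofReal_lt_top)]
    have h1 := integrableOn_Ioi_expParam
      (fun x => (ENNReal.ofReal (x ^ (2 * β - 1))).toReal • ‖f x‖ ^ 2)
    rw [IntegrableOn] at h1
    rw [h1, ← integrable_const_mul_iff (isUnit_iff_ne_zero.2 Real.two_pi_pos.ne')]
    refine integrable_congr (Eventually.of_forall fun ξ => ?_)
    have hp := expParam_pos ξ
    have hpi := Real.pi_pos
    simp only [logPullback]
    rw [ENNReal.toReal_ofReal (Real.rpow_nonneg hp.le _), norm_mul, Complex.norm_real,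
      Real.norm_of_nonneg (by positivity), Real.rpow_sub_one hp.ne', two_mul β,
      Real.rpow_add hp, smul_eq_mul]
    field_simp
  constructor
  · intro h
    exact (memLp_two_iff_integrable_sq_norm
      ((aestronglyMeasurable_weightMeasure_iff β f).1 h.1)).2
      (key.1 ((memLp_two_iff_integrable_sq_norm h.1).1 h))
  · intro h
    exact (memLp_two_iff_integrable_sq_norm
      ((aestronglyMeasurable_weightMeasure_iff β f).2 h.1)).2
      (key.2 ((memLp_two_iff_integrable_sq_norm h.1).1 h))

/-- The parameters of the points of `(1 / N, N]`. -/
def paramSet (N : ℝ) : Set ℝ := expParam ⁻¹' Ioc N⁻¹ N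

theorem measurableSet_paramSet (N : ℝ) : MeasurableSet (paramSet N) :=
  continuous_expParam.measurable measurableSet_Ioc

theorem paramSet_subset {N : ℝ} (hN : 0 < N) : paramSet N ⊆ Icc (-N) N := by
  rintro ξ ⟨h1, h2⟩
  have hpi := Real.pi_gt_three
  have h3 : 2 * Real.pi * ξ + 1 ≤ N := (Real.add_one_le_exp _).trans h2
  have h4 : -(2 * Real.pi * ξ) + 1 ≤ N := by
    refine (Real.add_one_le_exp _).trans ?_
    rw [Real.exp_neg]
    exact (inv_lt_of_inv_lt₀ hN h1).le
  constructor <;> nlinarith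

theorem eventually_mem_paramSet (ξ : ℝ) : ∀ᶠ N in atTop, ξ ∈ paramSet N := by
  filter_upwards [eventually_gt_atTop (expParam ξ), eventually_gt_atTop (expParam ξ)⁻¹] with N h1 h2
  exact ⟨inv_lt_of_inv_lt₀ (expParam_pos ξ) h2, h1.le⟩

theorem cpow_expParam (ξ : ℝ) (s : ℂ) :
    (expParam ξ : ℂ) ^ s = Complex.exp (2 * Real.pi * ξ * s) := by
  rw [expParam, Complex.ofReal_exp, ← Complex.ofReal_exp,
    Complex.cpow_def_of_ne_zero (by exact_mod_cast (Real.exp_pos _).ne'), ← Complex.ofReal_log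
      (Real.exp_pos _).le, Real.log_exp]
  push_cast
  rfl

open FourierTransform in
/-- A truncated Mellin integral is the inverse Fourier transform of a truncated function. -/
theorem integral_truncated_mellin (β : ℝ) (f : ℝ → ℂ) {N : ℝ} (hN : 0 < N) (τ : ℝ) :
    ∫ t in Ioc N⁻¹ N, f t * (t : ℂ) ^ (vpt β τ - 1)
      = 𝓕⁻ ((paramSet N).indicator (logPullback β f)) τ := by
  rw [← inter_eq_right.2 (show Ioc N⁻¹ N ⊆ Ioi 0 from fun t ht => (inv_pos.2 hN).trans ht.1),
    ← setIntegral_indicator measurableSet_Ioc, integral_Ioi_expParam, Real.fourierInv_eq']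
  congr 1
  funext ξ
  by_cases h : ξ ∈ paramSet N
  · have h' : expParam ξ ∈ Ioc N⁻¹ N := h
    have h0 : (expParam ξ : ℂ) ≠ 0 := by exact_mod_cast (expParam_pos ξ).ne'
    rw [indicator_of_mem h, indicator_of_mem h', logPullback, Complex.real_smul, smul_eq_mul,
      Complex.ofReal_mul _ (expParam ξ ^ β), Complex.ofReal_cpow (expParam_pos ξ).le,
      Complex.cpow_sub _ _ h0, Complex.cpow_one, vpt, Complex.cpow_add _ _ h0,
      cpow_expParam ξ (τ * Complex.I)]
    have : (2 * Real.pi * ξ * (τ * Complex.I) : ℂ)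
        = ((2 * Real.pi * inner ℝ ξ τ : ℝ) : ℂ) * Complex.I := by
      rw [Real.inner_apply]
      push_cast
      ring
    rw [this]
    push_cast
    field_simp
  · have h' : expParam ξ ∉ Ioc N⁻¹ N := h
    rw [indicator_of_notMem h, indicator_of_notMem h', smul_zero, smul_zero]

open FourierTransform in
/-- In logarithmic coordinates the inversion integral is a Fourier integral. -/
theorem logPullback_invLine (β : ℝ) (p : ℝ → ℂ) : logPullback β (invLine β p) = 𝓕 p := by
  funext ξ
  have hpi : (Real.pi : ℂ) ≠ 0 := by exact_mod_cast Real.pi_ne_zero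
  have h0 : (expParam ξ : ℂ) ≠ 0 := by exact_mod_cast (expParam_pos ξ).ne'
  rw [logPullback, invLine, Real.fourier_eq', ← mul_assoc, ← integral_const_mul]
  congr 1
  funext τ
  have : ((-2 * Real.pi * inner ℝ τ ξ : ℝ) : ℂ) * Complex.I
      = (2 * Real.pi * ξ * -(τ * Complex.I) : ℂ) := by
    rw [Real.inner_apply]
    push_cast
    ring
  rw [this, ← cpow_expParam, vpt, neg_add, Complex.cpow_add _ _ h0, Complex.cpow_neg _ (β : ℂ),
    Complex.ofReal_mul, Complex.ofReal_cpow (expParam_pos ξ).le, smul_eq_mul]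
  have : (expParam ξ : ℂ) ^ (β : ℂ) ≠ 0 := by simp [Complex.cpow_eq_zero_iff, h0]
  push_cast
  field_simp

theorem tendsto_indicator_paramSet {v : ℝ → ℂ} (hv : MemLp v 2) :
    Tendsto (fun N => (hv.indicator (measurableSet_paramSet N)).toLp _) atTop (𝓝 (hv.toLp v)) := by
  rw [Lp.tendsto_Lp_iff_tendsto_eLpNorm'']
  have h2 : (2 : ENNReal) ≠ 0 := by norm_num
  have h3 : (2 : ENNReal) ≠ ⊤ := by norm_num
  simp only [eLpNorm_eq_lintegral_rpow_enorm_toReal h2 h3]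
  have hfin := hv.2
  rw [eLpNorm_eq_lintegral_rpow_enorm_toReal h2 h3] at hfin
  have hlim : Tendsto (fun N => ∫⁻ ξ, ‖((paramSet N).indicator v - v) ξ‖ₑ ^ (2 : ENNReal).toReal)
      atTop (𝓝 (∫⁻ _ : ℝ, 0)) := by
    refine tendsto_lintegral_filter_of_dominated_convergence'
      (fun ξ => ‖v ξ‖ₑ ^ (2 : ENNReal).toReal) ?_ ?_ ?_ ?_
    · refine Eventually.of_forall fun N => ?_
      exact (((hv.1.indicator (measurableSet_paramSet N)).sub hv.1).enorm).pow_const _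
    · refine Eventually.of_forall fun N => Eventually.of_forall fun ξ => ?_
      refine ENNReal.rpow_le_rpow ?_ (by norm_num)
      rw [Pi.sub_apply]
      by_cases h : ξ ∈ paramSet N
      · simp [indicator_of_mem h]
      · simp [indicator_of_notMem h]
    · intro h
      rw [h] at hfin
      norm_num at hfin
    · refine Eventually.of_forall fun ξ => ?_
      refine tendsto_const_nhds.congr' ?_
      filter_upwards [eventually_mem_paramSet ξ] with N hN
      simp [indicator_of_mem hN]
  rw [lintegral_zero] at hlim
  have := hlim.ennrpow_const (1 / (2 : ENNReal).toReal)
  rwa [ENNReal.zero_rpow_of_pos (by norm_num)] at this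

open FourierTransform in
/-- The truncated Mellin integrals converge to `p` in `L²` exactly when `p` is the inverse Fourier
transform of the function obtained by the logarithmic change of variables. -/
theorem tendsto_truncated_mellin_iff {β : ℝ} {f : ℝ → ℂ} {p : ℝ → ℂ}
    (hv : MemLp (logPullback β f) 2) (hp : MemLp p 2) :
    Tendsto (fun N : ℝ => eLpNorm
      (fun τ : ℝ => (∫ t in Ioc N⁻¹ N, f t * (t : ℂ) ^ (vpt β τ - 1)) - p τ) 2 volume) atTop (𝓝 0)
      ↔ (𝓕⁻ (hv.toLp _) : Lp ℂ 2 (volume : Measure ℝ)) = hp.toLp p := by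
  set G : ℝ → Lp ℂ 2 (volume : Measure ℝ) :=
    fun N => 𝓕⁻ ((hv.indicator (measurableSet_paramSet N)).toLp _) with hG
  have hlim : Tendsto G atTop (𝓝 (𝓕⁻ (hv.toLp _))) :=
    ((Lp.fourierTransformₗᵢ ℝ ℂ).symm.continuous.tendsto _).comp (tendsto_indicator_paramSet hv)
  have hae : ∀ N : ℝ, 0 < N → eLpNorm
      (fun τ : ℝ => (∫ t in Ioc N⁻¹ N, f t * (t : ℂ) ^ (vpt β τ - 1)) - p τ) 2 volume
        = eLpNorm (⇑(G N) - p) 2 volume := by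
    intro N hN
    -- the truncation is to a bounded set, so the truncated function is in `L¹ ∩ L²`
    have hi : Integrable ((paramSet N).indicator (logPullback β f)) := by
      rw [integrable_indicator_iff (measurableSet_paramSet N)]
      have : IsFiniteMeasure (volume.restrict (paramSet N)) :=
        ⟨by
          rw [Measure.restrict_apply_univ]
          exact (measure_mono (paramSet_subset hN)).trans_lt measure_Icc_lt_top⟩
      exact hv.restrict (paramSet N) |>.integrable (by norm_num)
    refine eLpNorm_congr_ae ?_
    filter_upwards [coe_fourierInv_toLp hi (hv.indicator (measurableSet_paramSet N))] with τ hτ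
    rw [integral_truncated_mellin β f hN, Pi.sub_apply, hG, hτ]
  rw [tendsto_congr' (by
    filter_upwards [eventually_gt_atTop 0] with N hN using hae N hN),
    ← Lp.tendsto_Lp_iff_tendsto_eLpNorm G p hp]
  exact ⟨fun h => tendsto_nhds_unique hlim h, fun h => h ▸ hlim⟩

open FourierTransform in
/-- The inverse Mellin transform of a function in `L¹ ∩ L²` has that function as its mean-square
Mellin transform. -/
theorem isMellin_invLine {β : ℝ} {f : ℝ → ℂ} {F : ℂ → ℂ}
    (h1 : Integrable fun τ => F (vpt β τ)) (h2 : MemLp (fun τ => F (vpt β τ)) 2)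
    (hf : ∀ t, 0 < t → f t = invLine β (fun τ => F (vpt β τ)) t) : IsMellin β f F := by
  have hU : logPullback β f = 𝓕 fun τ => F (vpt β τ) := by
    rw [← logPullback_invLine β]
    funext ξ
    rw [logPullback, logPullback, hf _ (expParam_pos ξ)]
  have hae := coe_fourier_toLp h1 h2
  have hv : MemLp (logPullback β f) 2 := by
    rw [hU]
    exact (memLp_congr_ae hae).1 (Lp.memLp _)
  refine ⟨(memLp_weightMeasure_iff β f).2 hv, h2, (tendsto_truncated_mellin_iff hv h2).2 ?_⟩
  have : hv.toLp _ = 𝓕 (h2.toLp _) := by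
    rw [Lp.ext_iff]
    filter_upwards [hv.coeFn_toLp, hae] with ξ e1 e2
    rw [e1, e2, hU]
  rw [this, fourierInv_fourier_eq]

open FourierTransform in
/-- A function with an integrable Mellin transform is almost everywhere given by the inversion
integral. -/
theorem IsMellin.ae_eq_invLine {β : ℝ} {f : ℝ → ℂ} {F : ℂ → ℂ} (h : IsMellin β f F)
    (h1 : Integrable fun τ => F (vpt β τ)) :
    ∀ᵐ t ∂(volume.restrict (Ioi (0 : ℝ))), f t = invLine β (fun τ => F (vpt β τ)) t := by
  obtain ⟨hf, h2, hlim⟩ := h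
  have hv := (memLp_weightMeasure_iff β f).1 hf
  have e := (tendsto_truncated_mellin_iff hv h2).1 hlim
  have e2 : hv.toLp _ = 𝓕 (h2.toLp _) := by
    rw [← e, fourier_fourierInv_eq]
  rw [← ae_expParam_iff]
  filter_upwards [hv.coeFn_toLp, coe_fourier_toLp h1 h2] with ξ e3 e4
  have hpos := Real.rpow_pos_of_pos (expParam_pos ξ) β
  have h3 : (2 * Real.pi * expParam ξ ^ β : ℝ) ≠ 0 := by
    have := Real.pi_pos
    positivity
  rw [e2, e4, ← logPullback_invLine β] at e3
  exact (mul_left_cancel₀ (by exact_mod_cast h3) e3).symm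

/-! ### Convolutions on vertical lines -/

/-- `P` and `s P(s)` in `L²` of a vertical line give the weighted integrability: by Cauchy–Schwarz
against `(1 + |τ|)^{-3/4}`. -/
theorem weightedL1_of_memLpLine {α : ℝ} (h0 : 0 < α) {F : ℂ → ℂ} (h2 : MemLpLine F 2 α)
    (h : MemLpLine (fun s => s * F s) 2 α) : WeightedL1 fun τ => F (vpt α τ) := by
  have A : MemLp (fun τ : ℝ => (((1 + |τ|) ^ (-(3 / 4) : ℝ) : ℝ) : ℂ)) 2 := by
    have hm : Measurable fun τ : ℝ => (((1 + |τ|) ^ (-(3 / 4) : ℝ) : ℝ) : ℂ) := by fun_prop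
    rw [memLp_two_iff_integrable_sq_norm hm.aestronglyMeasurable]
    have hi := integrable_one_add_norm (E := ℝ) (μ := volume) (r := 3 / 2) (by norm_num)
    refine hi.congr (Eventually.of_forall fun τ => ?_)
    have hp : 0 < 1 + |τ| := by positivity
    simp only [Complex.norm_real, Real.norm_eq_abs, sq_abs]
    rw [← Real.rpow_natCast, ← Real.rpow_mul hp.le]
    norm_num
  have B : MemLp (fun τ : ℝ => ((1 + |τ| : ℝ) : ℂ) * F (vpt α τ)) 2 := by
    have hm : Measurable fun τ : ℝ => ((1 + |τ| : ℝ) : ℂ) := by fun_prop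
    refine h.of_le_mul (c := 1 + α⁻¹) (hm.aestronglyMeasurable.mul h2.1)
      (Eventually.of_forall fun τ => ?_)
    rw [norm_mul, norm_mul, ← mul_assoc, Complex.norm_real, Real.norm_of_nonneg (by positivity)]
    refine mul_le_mul_of_nonneg_right ?_ (norm_nonneg _)
    have e1 : α ≤ ‖vpt α τ‖ := by simpa using Complex.re_le_norm (vpt α τ)
    have e2 : |τ| ≤ ‖vpt α τ‖ := by simpa using Complex.abs_im_le_norm (vpt α τ)
    have e3 : 1 ≤ α⁻¹ * ‖vpt α τ‖ := by
      rw [inv_mul_eq_div, le_div_iff₀ h0]; linarith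
    linarith
  refine (A.integrable_mul B).congr (Eventually.of_forall fun τ => ?_)
  have hp : 0 < 1 + |τ| := by positivity
  have e : wt τ = (1 + |τ|) ^ (-(3 / 4) : ℝ) * (1 + |τ|) := by
    rw [← Real.rpow_add_one hp.ne', wt]; norm_num
  simp only [Pi.mul_apply]
  rw [e, Complex.ofReal_mul, mul_assoc]

theorem WeightedL1.bdd_mul {p m : ℝ → ℂ} (hp : WeightedL1 p) (hm : Measurable m) {C : ℝ}
    (hC : ∀ τ, ‖m τ‖ ≤ C) : WeightedL1 fun τ => m τ * p τ := by
  refine (Integrable.bdd_mul hp hm.aestronglyMeasurable (Eventually.of_forall hC)).congr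
    (Eventually.of_forall fun τ => ?_)
  ring

theorem memLp_bdd_mul {p m : ℝ → ℂ} (hp : MemLp p 2) (hm : Measurable m) {C : ℝ}
    (hC : ∀ τ, ‖m τ‖ ≤ C) : MemLp (fun τ => m τ * p τ) 2 := by
  refine hp.of_le_mul (c := C) (hm.aestronglyMeasurable.mul hp.1) (Eventually.of_forall fun τ => ?_)
  rw [norm_mul]
  exact mul_le_mul_of_nonneg_right (hC τ) (norm_nonneg _)

/-- The convolution on the real line, with the translation in the first factor. -/
def lineConv (p q : ℝ → ℂ) (τ : ℝ) : ℂ := ∫ θ : ℝ, p (τ - θ) * q θ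

theorem integrable_lineConv_integrand {p q : ℝ → ℂ} (hp : Integrable p) (hq : Integrable q) :
    Integrable (fun z : ℝ × ℝ => p (z.1 - z.2) * q z.2) := by
  have := hq.convolution_integrand (ContinuousLinearMap.mul ℝ ℂ) hp
  refine this.congr (Eventually.of_forall fun z => ?_)
  simp [mul_comm]

theorem integrable_lineConv {p q : ℝ → ℂ} (hp : Integrable p) (hq : Integrable q) :
    Integrable (lineConv p q) :=
  (integrable_lineConv_integrand hp hq).integral_prod_left

/-- The weight is submultiplicative, so the weighted space is closed under convolution. -/
theorem WeightedL1.lineConv {p q : ℝ → ℂ} (hp : WeightedL1 p) (hq : WeightedL1 q) :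
    WeightedL1 (lineConv p q) := by
  have hi := (integrable_lineConv_integrand hp hq).norm
  refine hi.integral_prod_left.mono' ?_ ?_
  · exact (Complex.continuous_ofReal.comp continuous_wt).aestronglyMeasurable.mul
      (integrable_lineConv hp.integrable hq.integrable).1
  · filter_upwards [hi.prod_right_ae] with τ hτ
    rw [HalfHilbert.lineConv, ← integral_const_mul]
    refine norm_integral_le_of_norm_le hτ (Eventually.of_forall fun θ => ?_)
    simp only [norm_mul, Complex.norm_real, Real.norm_of_nonneg (wt_pos _).le]
    have := mul_le_mul_of_nonneg_right (wt_sub_mul_le τ θ)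
      (mul_nonneg (norm_nonneg (p (τ - θ))) (norm_nonneg (q θ)))
    refine this.trans (le_of_eq ?_)
    ring

theorem memLp_comp_sub_left {p : ℝ → ℂ} (hp : MemLp p 2) (τ : ℝ) :
    MemLp (fun θ => p (τ - θ)) 2 :=
  hp.comp_measurePreserving (Measure.measurePreserving_sub_left volume τ)

theorem integrable_sub_mul {p q : ℝ → ℂ} (hp : MemLp p 2) (hq : MemLp q 2) (τ : ℝ) :
    Integrable fun θ => p (τ - θ) * q θ :=
  (memLp_comp_sub_left hp τ).integrable_mul hq

/-- The convolution of two functions in `L¹ ∩ L²` is integrable and bounded, hence in `L²`. -/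
theorem memLp_lineConv {p q : ℝ → ℂ} (hp1 : Integrable p) (hq1 : Integrable q) (hp : MemLp p 2)
    (hq : MemLp q 2) : MemLp (lineConv p q) 2 := by
  have hi := integrable_lineConv hp1 hq1
  have sp := (memLp_two_iff_integrable_sq_norm hp.1).1 hp
  have sq := (memLp_two_iff_integrable_sq_norm hq.1).1 hq
  set C := (∫ θ, ‖p θ‖ ^ 2) + ∫ θ, ‖q θ‖ ^ 2
  have hb : ∀ τ, ‖lineConv p q τ‖ ≤ C := by
    intro τ
    have e : C = ∫ θ, (‖p (τ - θ)‖ ^ 2 + ‖q θ‖ ^ 2) := by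
      rw [integral_add (sp.comp_sub_left τ) sq, integral_sub_left_eq_self (fun θ => ‖p θ‖ ^ 2)]
    rw [e]
    refine norm_integral_le_of_norm_le ((sp.comp_sub_left τ).add sq)
      (Eventually.of_forall fun θ => ?_)
    rw [norm_mul]
    nlinarith [sq_nonneg (‖p (τ - θ)‖ - ‖q θ‖), sq_nonneg ‖p (τ - θ)‖, sq_nonneg ‖q θ‖]
  rw [memLp_two_iff_integrable_sq_norm hi.1]
  refine (hi.norm.const_mul C).mono' (hi.1.norm.pow 2) (Eventually.of_forall fun τ => ?_)
  rw [Real.norm_of_nonneg (by positivity), pow_two]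
  exact mul_le_mul_of_nonneg_right (hb τ) (norm_nonneg _)

/-- A double integral whose kernel is a function of the sum of the variables. -/
theorem integral_prod_add_eq {p q m : ℝ → ℂ} (hp : Integrable p) (hq : Integrable q)
    (hm : Measurable m) {C : ℝ} (hC : ∀ τ, ‖m τ‖ ≤ C) :
    Integrable (fun z : ℝ × ℝ => m (z.1 + z.2) * (p z.1 * q z.2)) ∧
    ∫ z : ℝ × ℝ, m (z.1 + z.2) * (p z.1 * q z.2) = ∫ τ, m τ * lineConv p q τ := by
  have h1 : Integrable (fun z : ℝ × ℝ => m (z.1 + z.2) * (p z.1 * q z.2)) :=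
    (hp.mul_prod hq).bdd_mul (hm.comp (measurable_fst.add measurable_snd)).aestronglyMeasurable
      (Eventually.of_forall fun z => hC _)
  have h2 : Integrable (fun z : ℝ × ℝ => m z.1 * (p (z.1 - z.2) * q z.2)) :=
    (integrable_lineConv_integrand hp hq).bdd_mul (hm.comp measurable_fst).aestronglyMeasurable
      (Eventually.of_forall fun z => hC _)
  refine ⟨h1, ?_⟩
  rw [Measure.volume_eq_prod, integral_prod_symm _ h1]
  simp only [lineConv, ← integral_const_mul]
  rw [integral_integral_swap (f := fun τ θ => m τ * (p (τ - θ) * q θ)) h2]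
  congr 1
  funext θ
  rw [← integral_sub_right_eq_self (fun τ => m (τ + θ) * (p τ * q θ)) θ]
  simp only [sub_add_cancel]

theorem vpt_add (α a b : ℝ) : vpt α a + vpt α b = vpt (2 * α) (a + b) := by
  simp only [vpt]; push_cast; ring

theorem norm_cpow_vpt {x : ℝ} (hx : 0 < x) (β τ : ℝ) : ‖(x : ℂ) ^ (-(vpt β τ))‖ = x ^ (-β) := by
  rw [Complex.norm_cpow_eq_rpow_re_of_pos hx, Complex.neg_re, vpt_re]

theorem measurable_cpow_vpt_right (x β : ℝ) : Measurable fun τ => (x : ℂ) ^ (-(vpt β τ)) := by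
  have := (continuous_vpt β).measurable
  fun_prop

theorem integrable_mul_cpow {p : ℝ → ℂ} (hp : Integrable p) {x : ℝ} (hx : 0 < x) (β : ℝ) :
    Integrable fun τ => p τ * (x : ℂ) ^ (-(vpt β τ)) :=
  hp.mul_bdd (c := x ^ (-β)) (measurable_cpow_vpt_right x β).aestronglyMeasurable
    (Eventually.of_forall fun τ => (norm_cpow_vpt hx β τ).le)

theorem invLine_add_sub {p q r : ℝ → ℂ} (hp : Integrable p) (hq : Integrable q)
    (hr : Integrable r) {x : ℝ} (hx : 0 < x) (β : ℝ) :
    invLine β (fun τ => p τ + q τ - r τ) x = invLine β p x + invLine β q x - invLine β r x := by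
  have ip := integrable_mul_cpow hp hx β
  have iq := integrable_mul_cpow hq hx β
  have e := integral_sub (ip.add iq) (integrable_mul_cpow hr hx β)
  simp only [Pi.add_apply] at e
  simp only [invLine, add_mul, sub_mul]
  rw [e, integral_add ip iq]
  ring

/-- A shift of the line by `1 / 2` divides the inverse Mellin transform by `√x`. -/
theorem invLine_add_half (β : ℝ) (p : ℝ → ℂ) {x : ℝ} (hx : 0 < x) :
    invLine (β + 1 / 2) p x = invLine β p x / ((√x : ℝ) : ℂ) := by
  have hx0 : (x : ℂ) ≠ 0 := by exact_mod_cast hx.ne'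
  have e : ((√x : ℝ) : ℂ) = (x : ℂ) ^ (1 / 2 : ℂ) := by
    rw [Real.sqrt_eq_rpow, Complex.ofReal_cpow hx.le]
    push_cast
    rfl
  rw [invLine, invLine, mul_div_assoc, ← integral_div, e]
  congr 2
  funext τ
  have : -vpt (β + 1 / 2) τ = -vpt β τ - 1 / 2 := by
    simp only [vpt]; push_cast; ring
  rw [this, Complex.cpow_sub _ _ hx0, mul_div_assoc]

/-- The double inverse Mellin integral with a multiplier of the sum of the variables. -/
theorem double_integral_eq_invLine {α : ℝ} {p q m : ℝ → ℂ} (hp : Integrable p) (hq : Integrable q)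
    (hm : Measurable m) {C : ℝ} (hC : ∀ τ, ‖m τ‖ ≤ C) {x : ℝ} (hx : 0 < x) :
    Integrable (fun z : ℝ × ℝ =>
      m (z.1 + z.2) * (x : ℂ) ^ (-(vpt (2 * α) (z.1 + z.2))) * (p z.1 * q z.2)) ∧
    (1 / (2 * Real.pi)) ^ 2 * ∫ z : ℝ × ℝ,
      m (z.1 + z.2) * (x : ℂ) ^ (-(vpt (2 * α) (z.1 + z.2))) * (p z.1 * q z.2)
      = invLine (2 * α) (fun τ => m τ * (1 / (2 * Real.pi) * lineConv p q τ)) x := by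
  have hb : ∀ τ, ‖m τ * (x : ℂ) ^ (-(vpt (2 * α) τ))‖ ≤ C * x ^ (-(2 * α)) := by
    intro τ
    rw [norm_mul, norm_cpow_vpt hx]
    exact mul_le_mul_of_nonneg_right (hC τ) (Real.rpow_nonneg hx.le _)
  obtain ⟨h1, h2⟩ := integral_prod_add_eq hp hq
    (hm.mul (measurable_cpow_vpt_right x (2 * α))) hb
  refine ⟨h1, ?_⟩
  simp only [Pi.mul_apply] at h2
  rw [h2, invLine, pow_two, mul_assoc, ← integral_const_mul]
  congr 2
  funext τ
  ring

/-- A product of inverse Mellin transforms is the transform of a convolution on the doubled line. -/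
theorem invLine_mul_invLine {α : ℝ} {p q : ℝ → ℂ} (hp : Integrable p) (hq : Integrable q) {x : ℝ}
    (hx : 0 < x) : invLine α p x * invLine α q x
      = invLine (2 * α) (fun τ => 1 / (2 * Real.pi) * lineConv p q τ) x := by
  have hx0 : (x : ℂ) ≠ 0 := by exact_mod_cast hx.ne'
  have h := (double_integral_eq_invLine (α := α) hp hq (measurable_const (a := (1 : ℂ)))
    (C := 1) (by simp) hx).2
  simp only [one_mul] at h
  rw [← h, invLine, invLine, mul_mul_mul_comm, ← pow_two, ← integral_prod_mul]
  congr 2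
  funext z
  rw [← vpt_add, neg_add, Complex.cpow_add _ _ hx0]
  ring

/-- Inverse Mellin transforms with the weight are locally Hölder continuous of order `1/4`. -/
theorem exists_norm_invLine_sub_le {β : ℝ} (h0 : 0 < β) (h1 : β < 1) {p : ℝ → ℂ}
    (hp : WeightedL1 p) {x : ℝ} (hx : 0 < x) :
    ∃ C, ∀ t, x / 2 ≤ t → ‖invLine β p t - invLine β p x‖ ≤ C * |t - x| ^ (1 / 4 : ℝ) := by
  refine ⟨‖(1 / (2 * Real.pi) : ℂ)‖ * (x ^ (-β) * 4 * (x⁻¹) ^ (1 / 4 : ℝ)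
    * ∫ τ, ‖(wt τ : ℂ) * p τ‖), fun t ht => ?_⟩
  have ht0 : 0 < t := by linarith
  rw [invLine, invLine, ← mul_sub, ← integral_sub (integrable_mul_cpow hp.integrable ht0 β)
    (integrable_mul_cpow hp.integrable hx β), norm_mul, mul_assoc]
  refine mul_le_mul_of_nonneg_left ?_ (norm_nonneg _)
  rw [mul_right_comm, ← integral_const_mul]
  refine norm_integral_le_of_norm_le (hp.norm.const_mul _) (Eventually.of_forall fun τ => ?_)
  have hu := norm_cpow_neg_sub_one_le (s := vpt β τ) (by simpa using h0) (by simpa using h1)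
    (u := t / x) (by rw [le_div_iff₀ hx]; linarith)
  have e1 : (t : ℂ) ^ (-(vpt β τ)) = (x : ℂ) ^ (-(vpt β τ)) * ((t / x : ℝ) : ℂ) ^ (-(vpt β τ)) := by
    rw [← Complex.mul_cpow_ofReal_nonneg hx.le (by positivity), ← Complex.ofReal_mul,
      mul_div_cancel₀ _ hx.ne']
  have e2 : p τ * (t : ℂ) ^ (-(vpt β τ)) - p τ * (x : ℂ) ^ (-(vpt β τ))
      = p τ * ((x : ℂ) ^ (-(vpt β τ)) * (((t / x : ℝ) : ℂ) ^ (-(vpt β τ)) - 1)) := by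
    rw [e1]; ring
  have e3 : |t / x - 1| ^ (1 / 4 : ℝ) = (x⁻¹) ^ (1 / 4 : ℝ) * |t - x| ^ (1 / 4 : ℝ) := by
    rw [show t / x - 1 = x⁻¹ * (t - x) by field_simp, abs_mul, abs_of_pos (inv_pos.2 hx),
      Real.mul_rpow (by positivity) (by positivity)]
  rw [vpt_im, e3] at hu
  rw [e2, norm_mul, norm_mul, norm_cpow_vpt hx, norm_mul, Complex.norm_real,
    Real.norm_of_nonneg (wt_pos τ).le]
  have := mul_le_mul_of_nonneg_left hu (mul_nonneg (norm_nonneg (p τ)) (Real.rpow_nonneg hx.le (-β)))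
  rw [mul_assoc] at this
  refine this.trans (le_of_eq ?_)
  ring

theorem norm_invLine_le {β : ℝ} {p : ℝ → ℂ} (hp : Integrable p) {t : ℝ} (ht : 0 < t) :
    ‖invLine β p t‖ ≤ ‖(1 / (2 * Real.pi) : ℂ)‖ * (t ^ (-β) * ∫ τ, ‖p τ‖) := by
  rw [invLine, norm_mul, ← integral_const_mul]
  refine mul_le_mul_of_nonneg_left ?_ (norm_nonneg _)
  refine norm_integral_le_of_norm_le (hp.norm.const_mul _) (Eventually.of_forall fun τ => ?_)
  rw [norm_mul, norm_cpow_vpt ht, mul_comm]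

/-! ### The convolution of the half-Hilbert transform -/

theorem inv_cot_eq (z : ℂ) : (Complex.cot z)⁻¹ = -Complex.cot (z + Real.pi / 2) := by
  rw [Complex.cot, Complex.cot, inv_div, Complex.cos_add_pi_div_two, Complex.sin_add_pi_div_two,
    neg_div, neg_neg]

/-- The tangent is the symbol of the half-Hilbert transform on the line shifted by `1 / 2`. -/
theorem inv_cot_vpt (β τ : ℝ) : (Complex.cot (Real.pi * vpt β τ))⁻¹
    = -Complex.cot (Real.pi * vpt (β + 1 / 2) τ) := by
  rw [inv_cot_eq]
  congr 2
  simp only [vpt]; push_cast; ring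

theorem measurable_inv_cot_vpt (β : ℝ) :
    Measurable fun τ => (Complex.cot (Real.pi * vpt β τ))⁻¹ :=
  (measurable_cot_vpt β).inv

theorem norm_inv_cot_vpt_le {β : ℝ} (h0 : 0 < β) (h1 : β < 1 / 2) (τ : ℝ) :
    ‖(Complex.cot (Real.pi * vpt β τ))⁻¹‖ ≤ (Real.sin (Real.pi * (β + 1 / 2)))⁻¹ := by
  rw [inv_cot_vpt, norm_neg]
  exact norm_cot_vpt_le (by linarith) (by linarith) τ

theorem sin_pi_vpt_ne_zero {β : ℝ} (h0 : 0 < β) (h1 : β < 1) (τ : ℝ) :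
    Complex.sin (Real.pi * vpt β τ) ≠ 0 :=
  sin_pi_mul_ne_zero (mem_integerComplement (by simpa using h0) (by simpa using h1))

theorem cos_pi_vpt_ne_zero {β : ℝ} (h0 : 0 < β) (h1 : β < 1 / 2) (τ : ℝ) :
    Complex.cos (Real.pi * vpt β τ) ≠ 0 := by
  have h := sin_pi_vpt_ne_zero (β := β + 1 / 2) (by linarith) (by linarith) τ
  have e : (Real.pi * vpt (β + 1 / 2) τ : ℂ) = Real.pi * vpt β τ + Real.pi / 2 := by
    simp only [vpt]; push_cast; ring
  rwa [e, Complex.sin_add_pi_div_two] at h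

theorem cot_vpt_ne_zero {β : ℝ} (h0 : 0 < β) (h1 : β < 1 / 2) (τ : ℝ) :
    Complex.cot (Real.pi * vpt β τ) ≠ 0 :=
  div_ne_zero (cos_pi_vpt_ne_zero h0 h1 τ) (sin_pi_vpt_ne_zero h0 (by linarith) τ)

/-- The addition formula of the cotangent, in the form that splits the kernel of the convolution. -/
theorem inv_cot_mul_cot_mul_cot {a b : ℂ} (ha : Complex.sin a ≠ 0) (hb : Complex.sin b ≠ 0)
    (hc : Complex.cos (a + b) ≠ 0) : (Complex.cot (a + b))⁻¹ * (Complex.cot a * Complex.cot b)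
      = (Complex.cot (a + b))⁻¹ + Complex.cot a + Complex.cot b := by
  have h := Complex.cos_add a b
  simp only [Complex.cot, inv_div]
  rw [Complex.sin_add]
  generalize Complex.cos (a + b) = c at h hc
  field_simp
  linear_combination
    (-(Complex.sin a * Complex.cos b + Complex.cos a * Complex.sin b)) * h

/-- The multiplication of a function on the line `Re s = α` by the symbol `cot (π s)` of the
half-Hilbert transform. -/
def cotMul (α : ℝ) (p : ℝ → ℂ) (τ : ℝ) : ℂ := Complex.cot (Real.pi * vpt α τ) * p τ

theorem WeightedL1.cotMul {α : ℝ} (h0 : 0 < α) (h1 : α < 1) {p : ℝ → ℂ} (hp : WeightedL1 p) :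
    WeightedL1 (cotMul α p) :=
  hp.bdd_mul (measurable_cot_vpt α) (norm_cot_vpt_le h0 h1)

theorem memLp_cotMul {α : ℝ} (h0 : 0 < α) (h1 : α < 1) {p : ℝ → ℂ} (hp : MemLp p 2) :
    MemLp (cotMul α p) 2 :=
  memLp_bdd_mul hp (measurable_cot_vpt α) (norm_cot_vpt_le h0 h1)

theorem convMellinKernel_vpt (α : ℝ) (F G : ℂ → ℂ) (τ θ : ℝ) :
    convMellinKernel F G (vpt (2 * α) τ) (vpt α θ)
      = cotMul α (fun τ => F (vpt α τ)) (τ - θ) * cotMul α (fun τ => G (vpt α τ)) θ := by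
  have : vpt (2 * α) τ - vpt α θ = vpt α (τ - θ) := by simp only [vpt]; push_cast; ring
  simp only [convMellinKernel, cotMul, this]
  ring

theorem convMellin_vpt (α : ℝ) (F G : ℂ → ℂ) (τ : ℝ) :
    convMellin α F G (vpt (2 * α) τ) = (Complex.cot (Real.pi * vpt (2 * α) τ))⁻¹ *
      (1 / (2 * Real.pi) * lineConv (cotMul α fun τ => F (vpt α τ))
        (cotMul α fun τ => G (vpt α τ)) τ) := by
  simp only [convMellin, vintegral, convMellinKernel_vpt, lineConv]
  rw [one_div, one_div, mul_inv, mul_inv _ Complex.I]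
  have := Complex.I_ne_zero
  field_simp

theorem convKernel_vpt (α : ℝ) (F G : ℂ → ℂ) (x : ℝ) (z : ℝ × ℝ) :
    convKernel F G x (vpt α z.1) (vpt α z.2)
      = (Complex.cot (Real.pi * vpt (2 * α) (z.1 + z.2)))⁻¹ *
        (x : ℂ) ^ (-(vpt (2 * α) (z.1 + z.2))) *
        (cotMul α (fun τ => F (vpt α τ)) z.1 * cotMul α (fun τ => G (vpt α τ)) z.2) := by
  have : -vpt α z.1 - vpt α z.2 = -vpt (2 * α) (z.1 + z.2) := by rw [← vpt_add]; ring
  rw [convKernel, vpt_add, this]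
  simp only [cotMul]
  ring

section
variable {α : ℝ} {F G : ℂ → ℂ}

theorem integrable_convKernel (h0 : 0 < α) (h1 : α < 1 / 4) (hF : WeightedL1 fun τ => F (vpt α τ))
    (hG : WeightedL1 fun τ => G (vpt α τ)) {x : ℝ} (hx : 0 < x) :
    Integrable (fun p : ℝ × ℝ => convKernel F G x (vpt α p.1) (vpt α p.2)) := by
  simp only [convKernel_vpt]
  exact (double_integral_eq_invLine (hF.cotMul h0 (by linarith)).integrable
    (hG.cotMul h0 (by linarith)).integrable (measurable_inv_cot_vpt (2 * α))
    (norm_inv_cot_vpt_le (by linarith) (by linarith)) hx).1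

theorem conv_eq_invLine (h0 : 0 < α) (h1 : α < 1 / 4) (hF : WeightedL1 fun τ => F (vpt α τ))
    (hG : WeightedL1 fun τ => G (vpt α τ)) {x : ℝ} (hx : 0 < x) :
    conv α F G x = invLine (2 * α) (fun τ => convMellin α F G (vpt (2 * α) τ)) x := by
  have h := (double_integral_eq_invLine (α := α) (hF.cotMul h0 (by linarith)).integrable
    (hG.cotMul h0 (by linarith)).integrable (measurable_inv_cot_vpt (2 * α))
    (norm_inv_cot_vpt_le (by linarith) (by linarith)) hx).2
  simp only [convMellin_vpt, conv, vintegral₂, convKernel_vpt]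
  rw [← h, ← mul_assoc]
  congr 1
  have := Complex.I_ne_zero
  field_simp

theorem weightedL1_convMellin (h0 : 0 < α) (h1 : α < 1 / 4)
    (hF : WeightedL1 fun τ => F (vpt α τ)) (hG : WeightedL1 fun τ => G (vpt α τ)) :
    WeightedL1 fun τ => convMellin α F G (vpt (2 * α) τ) := by
  simp only [convMellin_vpt]
  exact (((hF.cotMul h0 (by linarith)).lineConv (hG.cotMul h0 (by linarith))).bdd_mul
    measurable_const fun _ => le_rfl).bdd_mul (measurable_inv_cot_vpt (2 * α))
    (norm_inv_cot_vpt_le (by linarith) (by linarith))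

theorem memLp_convMellin (h0 : 0 < α) (h1 : α < 1 / 4)
    (hF : WeightedL1 fun τ => F (vpt α τ)) (hG : WeightedL1 fun τ => G (vpt α τ))
    (hF2 : MemLpLine F 2 α) (hG2 : MemLpLine G 2 α) : MemLpLine (convMellin α F G) 2 (2 * α) := by
  simp only [MemLpLine, convMellin_vpt]
  exact memLp_bdd_mul (memLp_bdd_mul (memLp_lineConv (hF.cotMul h0 (by linarith)).integrable
    (hG.cotMul h0 (by linarith)).integrable (memLp_cotMul h0 (by linarith) hF2)
    (memLp_cotMul h0 (by linarith) hG2)) measurable_const fun _ => le_rfl)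
    (measurable_inv_cot_vpt (2 * α)) (norm_inv_cot_vpt_le (by linarith) (by linarith))

/-- The Mellin transform of the convolution splits into the terms of `(H₊ f) g`, of `f (H₊ g)` and
of the half-Hilbert transform of `f g / √t`. -/
theorem convMellin_vpt_split (h0 : 0 < α) (h1 : α < 1 / 4)
    (hF2 : MemLpLine F 2 α) (hG2 : MemLpLine G 2 α) (τ : ℝ) :
    convMellin α F G (vpt (2 * α) τ)
      = 1 / (2 * Real.pi) * lineConv (cotMul α fun τ => F (vpt α τ)) (fun τ => G (vpt α τ)) τ
        + 1 / (2 * Real.pi) * lineConv (fun τ => F (vpt α τ)) (cotMul α fun τ => G (vpt α τ)) τ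
        - Complex.cot (Real.pi * vpt (2 * α + 1 / 2) τ) * (1 / (2 * Real.pi) *
          lineConv (fun τ => F (vpt α τ)) (fun τ => G (vpt α τ)) τ) := by
  have cF := memLp_cotMul (α := α) h0 (by linarith) hF2
  have cG := memLp_cotMul (α := α) h0 (by linarith) hG2
  have j1 := integrable_sub_mul cF hG2 τ
  have j2 := integrable_sub_mul hF2 cG τ
  have j3 := (integrable_sub_mul hF2 hG2 τ).const_mul (Complex.cot (Real.pi * vpt (2 * α) τ))⁻¹
  rw [convMellin_vpt, sub_eq_add_neg, ← neg_mul, ← inv_cot_vpt, mul_left_comm, mul_left_comm _ (1 / _ : ℂ),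
    ← mul_add, ← mul_add]
  congr 1
  -- for a fixed `τ` all convolution integrals converge, so the identity may be checked pointwise
  simp only [lineConv]
  rw [← integral_const_mul, ← integral_const_mul, ← integral_add j1 j2]
  refine Eq.trans (integral_congr_ae (Eventually.of_forall fun θ => ?_))
    (integral_add (j1.add j2) j3)
  beta_reduce
  have e : (Real.pi * vpt (2 * α) τ : ℂ) = Real.pi * vpt α (τ - θ) + Real.pi * vpt α θ := by
    rw [← mul_add, vpt_add, sub_add_cancel]
  have hc := cos_pi_vpt_ne_zero (β := 2 * α) (by linarith) (by linarith) τ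
  rw [e] at hc
  have key := inv_cot_mul_cot_mul_cot (sin_pi_vpt_ne_zero h0 (by linarith) (τ - θ))
    (sin_pi_vpt_ne_zero h0 (by linarith) θ) hc
  rw [← e] at key
  simp only [cotMul]
  linear_combination (F (vpt α (τ - θ)) * G (vpt α θ)) * key

/-- Absolute convergence of the representation integral: near `x` by the Hölder continuity of
`g(t) / √t`, away from `x` termwise. -/
theorem integrableOn_reprIntegrand (h0 : 0 < α) (h1 : α < 1 / 4) {f g : ℝ → ℂ}
    (hF : WeightedL1 fun τ => F (vpt α τ)) (hG : WeightedL1 fun τ => G (vpt α τ))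
    (hfm : AEStronglyMeasurable f (volume.restrict (Ioi 0)))
    (hgm : AEStronglyMeasurable g (volume.restrict (Ioi 0)))
    (hf : ∀ᵐ t ∂(volume.restrict (Ioi (0 : ℝ))), f t = invLine α (fun τ => F (vpt α τ)) t)
    (hg : ∀ᵐ t ∂(volume.restrict (Ioi (0 : ℝ))), g t = invLine α (fun τ => G (vpt α τ)) t)
    {x : ℝ} (hx : 0 < x) (hgx : g x = invLine α (fun τ => G (vpt α τ)) x)
    (hout : IntegrableOn (reprIntegrand f g x) (truncDomain x (x / 4))) :
    IntegrableOn (reprIntegrand f g x) (Ioi 0) := by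
  have hm : AEStronglyMeasurable (reprIntegrand f g x) (volume.restrict (Ioi 0)) := by
    have m1 : Measurable fun t : ℝ => ((√t : ℝ) : ℂ) := by fun_prop
    have m2 : Measurable fun t : ℝ => ((t : ℂ) - x)⁻¹ := by fun_prop
    have m3 : Measurable fun t : ℝ => (((√t : ℝ) : ℂ))⁻¹ := by fun_prop
    unfold reprIntegrand
    simp only [div_eq_mul_inv]
    exact ((hfm.mul ((hgm.const_mul _).sub (m1.aestronglyMeasurable.mul_const _))).mul
      m2.aestronglyMeasurable).mul m3.aestronglyMeasurable
  obtain ⟨C, hC⟩ := exists_norm_invLine_sub_le (β := α + 1 / 2) (by linarith) (by linarith) hG hx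
  set M := ‖(1 / (2 * Real.pi) : ℂ)‖ * ((x / 2) ^ (-α) * ∫ τ, ‖F (vpt α τ)‖) with hM
  have hsub : Ioc (x / 2) (2 * x) ⊆ Ioi 0 := fun t ht => (by positivity : 0 < x / 2).trans ht.1
  have hin : IntegrableOn (reprIntegrand f g x) (Ioc (x / 2) (2 * x)) := by
    refine ((integrableOn_abs_sub_rpow x (show x / 2 ≤ 2 * x by linarith)).const_mul
      (M * √x * C)).mono' (hm.mono_set hsub) ?_
    filter_upwards [ae_restrict_mem measurableSet_Ioc, ae_restrict_of_ae_restrict_of_subset hsub hf,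
      ae_restrict_of_ae_restrict_of_subset hsub hg] with t ht hft hgt
    have ht0 : 0 < t := hsub ht
    have hMt : ‖f t‖ ≤ M := by
      rw [hft]
      refine (norm_invLine_le hF.integrable ht0).trans ?_
      have := Real.rpow_le_rpow_of_nonpos (by positivity) ht.1.le (show -α ≤ 0 by linarith)
      exact mul_le_mul_of_nonneg_left (mul_le_mul_of_nonneg_right this
        (integral_nonneg fun τ => norm_nonneg _)) (norm_nonneg _)
    have hst : ((√t : ℝ) : ℂ) ≠ 0 := by exact_mod_cast (Real.sqrt_pos.2 ht0).ne'
    have hsx : ((√x : ℝ) : ℂ) ≠ 0 := by exact_mod_cast (Real.sqrt_pos.2 hx).ne'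
    have hk := hC t ht.1.le
    rw [invLine_add_half α _ ht0, invLine_add_half α _ hx, ← hgt, ← hgx] at hk
    have hC0 : 0 ≤ C * |t - x| ^ (1 / 4 : ℝ) := (norm_nonneg _).trans hk
    have e : reprIntegrand f g x t = f t * ((√x : ℝ) : ℂ) *
        (g t / ((√t : ℝ) : ℂ) - g x / ((√x : ℝ) : ℂ)) / ((t : ℂ) - x) := by
      rw [reprIntegrand, div_right_comm]
      congr 1
      field_simp
    rcases eq_or_ne t x with rfl | hne
    · rw [e]
      simp
    have habs : 0 < |t - x| := abs_pos.2 (sub_ne_zero.2 hne)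
    have e4 : |t - x| ^ (1 / 4 : ℝ) = |t - x| ^ (-(3 / 4) : ℝ) * |t - x| := by
      rw [← Real.rpow_add_one habs.ne']; norm_num
    rw [e, norm_div, norm_mul, norm_mul, Complex.norm_real, Real.norm_of_nonneg (Real.sqrt_nonneg _),
      ← Complex.ofReal_sub, Complex.norm_real, Real.norm_eq_abs, div_le_iff₀ habs]
    calc ‖f t‖ * √x * ‖g t / ((√t : ℝ) : ℂ) - g x / ((√x : ℝ) : ℂ)‖
        ≤ M * √x * (C * |t - x| ^ (1 / 4 : ℝ)) := by gcongr
      _ = M * √x * C * |t - x| ^ (-(3 / 4) : ℝ) * |t - x| := by rw [e4]; ring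
  refine (hout.union hin).mono_set fun t (ht : 0 < t) => ?_
  by_cases h : x / 4 < |t - x|
  · exact Or.inl ⟨ht, h⟩
  · have := abs_le.1 (not_lt.1 h)
    exact Or.inr ⟨by linarith [this.1], by linarith [this.2]⟩

/-- For an integrable function the principal value is the integral. -/
theorem tendsto_setIntegral_truncDomain {h : ℝ → ℂ} (hi : IntegrableOn h (Ioi 0)) (x : ℝ) :
    Tendsto (fun ε => ∫ t in truncDomain x ε, h t) (𝓝[>] 0) (𝓝 (∫ t in Ioi (0 : ℝ), h t)) := by
  have e : ∀ ε, ∫ t in truncDomain x ε, h t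
      = ∫ t in Ioi (0 : ℝ), (truncDomain x ε).indicator h t := by
    intro ε
    rw [setIntegral_indicator (measurableSet_truncDomain x ε), inter_eq_right.2 fun t ht => ht.1]
  simp only [e]
  refine tendsto_integral_filter_of_dominated_convergence (fun t => ‖h t‖) ?_ ?_ hi.norm ?_
  · exact Eventually.of_forall fun ε => hi.1.indicator (measurableSet_truncDomain x ε)
  · exact Eventually.of_forall fun ε => Eventually.of_forall fun t => norm_indicator_le_norm_self _ _
  · have hne : ∀ᵐ t ∂(volume.restrict (Ioi (0 : ℝ))), t ≠ x :=
      ae_restrict_of_ae (Measure.ae_ne volume x)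
    filter_upwards [ae_restrict_mem measurableSet_Ioi, hne] with t ht htx
    refine tendsto_const_nhds.congr' ?_
    filter_upwards [Ioo_mem_nhdsGT (abs_pos.2 (sub_ne_zero.2 htx))] with ε hε
    rw [indicator_of_mem]
    exact ⟨ht, hε.2⟩

/-- The convolution through the half-Hilbert transforms of `f`, `g` and `f g / √t`, and then through
an absolutely convergent integral. -/
theorem conv_eq_repr (h0 : 0 < α) (h1 : α < 1 / 4) {f g : ℝ → ℂ}
    (hF : WeightedL1 fun τ => F (vpt α τ)) (hG : WeightedL1 fun τ => G (vpt α τ))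
    (hF2 : MemLpLine F 2 α) (hG2 : MemLpLine G 2 α)
    (hfm : AEStronglyMeasurable f (volume.restrict (Ioi 0)))
    (hgm : AEStronglyMeasurable g (volume.restrict (Ioi 0)))
    (hf : ∀ᵐ t ∂(volume.restrict (Ioi (0 : ℝ))), f t = invLine α (fun τ => F (vpt α τ)) t)
    (hg : ∀ᵐ t ∂(volume.restrict (Ioi (0 : ℝ))), g t = invLine α (fun τ => G (vpt α τ)) t)
    {x : ℝ} (hx : 0 < x) (hfx : f x = invLine α (fun τ => F (vpt α τ)) x)
    (hgx : g x = invLine α (fun τ => G (vpt α τ)) x) :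
    IntegrableOn (reprIntegrand f g x) (Ioi (0 : ℝ)) ∧
      conv α F G x = halfHilbert g x * f x
        - 1 / (Real.pi : ℂ) * ∫ t in Ioi (0 : ℝ), reprIntegrand f g x t := by
  have hα1 : α < 1 := by linarith
  have cF := hF.cotMul h0 hα1
  have cG := hG.cotMul h0 hα1
  obtain ⟨⟨fi, flim⟩, fH⟩ := halfHilbert_invLine h0 hα1 hF hf hx
  obtain ⟨-, gH⟩ := halfHilbert_invLine h0 hα1 hG hg hx
  have hP : WeightedL1 fun τ => 1 / (2 * Real.pi) *
      lineConv (fun τ => F (vpt α τ)) (fun τ => G (vpt α τ)) τ :=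
    (hF.lineConv hG).bdd_mul measurable_const fun _ => le_rfl
  have hh : ∀ᵐ t ∂(volume.restrict (Ioi (0 : ℝ))), f t * g t / ((√t : ℝ) : ℂ)
      = invLine (2 * α + 1 / 2) (fun τ => 1 / (2 * Real.pi) *
        lineConv (fun τ => F (vpt α τ)) (fun τ => G (vpt α τ)) τ) t := by
    filter_upwards [hf, hg, ae_restrict_mem measurableSet_Ioi] with t ef eg ht
    rw [ef, eg, invLine_mul_invLine hF.integrable hG.integrable ht, invLine_add_half _ _ ht]
  obtain ⟨⟨hi, hlim⟩, hH⟩ := halfHilbert_invLine (by linarith) (by linarith) hP hh hx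
  have hsx : ((√x : ℝ) : ℂ) ≠ 0 := by exact_mod_cast (Real.sqrt_pos.2 hx).ne'
  have hrepr : ∀ t : ℝ, 0 < t → reprIntegrand f g x t
      = ((√x : ℝ) : ℂ) * (f t * g t / ((√t : ℝ) : ℂ) / ((t : ℂ) - x))
        - g x * (f t / ((t : ℂ) - x)) := by
    intro t ht
    have hst : ((√t : ℝ) : ℂ) ≠ 0 := by exact_mod_cast (Real.sqrt_pos.2 ht).ne'
    rw [reprIntegrand]
    field_simp
  have htr : ∀ ε, 0 < ε → IntegrableOn (reprIntegrand f g x) (truncDomain x ε) ∧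
      ∫ t in truncDomain x ε, reprIntegrand f g x t
      = ((√x : ℝ) : ℂ) * (∫ t in truncDomain x ε, f t * g t / ((√t : ℝ) : ℂ) / ((t : ℂ) - x))
        - g x * ∫ t in truncDomain x ε, f t / ((t : ℂ) - x) := by
    intro ε hε
    have hmem := measurableSet_truncDomain x ε
    have i := ((hi ε hε).const_mul ((√x : ℝ) : ℂ)).sub ((fi ε hε).const_mul (g x))
    refine ⟨i.congr ?_, ?_⟩
    · filter_upwards [ae_restrict_mem hmem] with t ht
      exact (hrepr t ht.1).symm
    · rw [← integral_const_mul, ← integral_const_mul,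
        ← integral_sub ((hi ε hε).const_mul _) ((fi ε hε).const_mul _)]
      exact setIntegral_congr_fun hmem fun t ht => hrepr t ht.1
  have hint := integrableOn_reprIntegrand h0 h1 hF hG hfm hgm hf hg hx hgx
    (htr (x / 4) (by positivity)).1
  refine ⟨hint, ?_⟩
  have lim1 := (tendsto_setIntegral_truncDomain hint x).const_mul (1 / (Real.pi : ℂ))
  have lim2 := (hlim.const_mul ((√x : ℝ) : ℂ)).sub (flim.const_mul (g x))
  -- the principal values of `√x f g / √t` and `f` combine to the absolutely convergent integral
  have heq := tendsto_nhds_unique (lim1.congr' (by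
    filter_upwards [self_mem_nhdsWithin] with ε hε
    rw [(htr ε hε).2]
    simp only [truncHilbert]
    ring)) lim2
  have e1 := invLine_mul_invLine (α := α) cF.integrable hG.integrable hx
  have e2 := invLine_mul_invLine (α := α) hF.integrable cG.integrable hx
  have i1 : Integrable fun τ => 1 / (2 * Real.pi : ℂ) *
      lineConv (cotMul α fun τ => F (vpt α τ)) (fun τ => G (vpt α τ)) τ :=
    (integrable_lineConv cF.integrable hG.integrable).const_mul _
  have i2 : Integrable fun τ => 1 / (2 * Real.pi : ℂ) *
      lineConv (fun τ => F (vpt α τ)) (cotMul α fun τ => G (vpt α τ)) τ :=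
    (integrable_lineConv hF.integrable cG.integrable).const_mul _
  have i3 := (hP.bdd_mul (measurable_cot_vpt (2 * α + 1 / 2))
    (norm_cot_vpt_le (by linarith) (by linarith))).integrable
  have e3 : conv α F G x = halfHilbert f x * g x + f x * halfHilbert g x
      - ((√x : ℝ) : ℂ) * halfHilbert (fun t => f t * g t / ((√t : ℝ) : ℂ)) x := by
    rw [conv_eq_invLine h0 h1 hF hG hx]
    simp only [convMellin_vpt_split h0 h1 hF2 hG2]
    rw [invLine_add_sub i1 i2 i3 hx, ← e1, ← e2, fH, gH, hfx, hgx, hH, invLine_add_half _ _ hx,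
      mul_div_cancel₀ _ hsx]
    rfl
  rw [heq, e3]
  ring

end

end HalfHilbert

end

theorem theorem3 (α : ℝ) (hα₀ : 0 < α) (hα₁ : α < 1 / 4)
    (f g : ℝ → ℂ) (F G : ℂ → ℂ)
    (hf : IsMellin α f F) (hg : IsMellin α g G)
    (hF : MemLpLine (fun s => s * F s) 2 α) (hG : MemLpLine (fun s => s * G s) 2 α) :
    -- the convolution integral converges absolutely at every `x > 0`
    (∀ x : ℝ, 0 < x →
      Integrable (fun p : ℝ × ℝ => convKernel F G x (vpt α p.1) (vpt α p.2))) ∧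
    -- its Mellin transform is in `L_2(σ_{2α})` and is given by an absolutely convergent integral
    (∀ τ : ℝ, Integrable (fun θ : ℝ => convMellinKernel F G (vpt (2 * α) τ) (vpt α θ))) ∧
    IsMellin (2 * α) (conv α F G) (convMellin α F G) ∧
    -- the factorization equality
    (∀ x : ℝ, 0 < x →
      HalfHilbertExists f x ∧ HalfHilbertExists g x ∧ HalfHilbertExists (conv α F G) x ∧
      halfHilbert (conv α F G) x = halfHilbert f x * halfHilbert g x) ∧
    -- the inversion formula holds for `f` and `g` almost everywhere
    (∀ᵐ x ∂(volume.restrict (Ioi (0 : ℝ))), f x = mellinInversion α F x) ∧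
    (∀ᵐ x ∂(volume.restrict (Ioi (0 : ℝ))), g x = mellinInversion α G x) ∧
    -- the representation of the convolution, at every `x > 0` where `f` and `g` have the
    -- values given by the inversion formula
    (MemLpLine (fun s => s * F s) 1 α → MemLpLine (fun s => s * G s) 1 α →
      ∀ x : ℝ, 0 < x → f x = mellinInversion α F x → g x = mellinInversion α G x →
        IntegrableOn (reprIntegrand f g x) (Ioi (0 : ℝ)) ∧
        conv α F G x = halfHilbert g x * f x
          - 1 / (Real.pi : ℂ) * ∫ t in Ioi (0 : ℝ), reprIntegrand f g x t) := by
  have hF1 := weightedL1_of_memLpLine hα₀ hf.2.1 hF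
  have hG1 := weightedL1_of_memLpLine hα₀ hg.2.1 hG
  have ef := hf.ae_eq_invLine hF1.integrable
  have eg := hg.ae_eq_invLine hG1.integrable
  have hα : α < 1 := by linarith
  have cF := hF1.cotMul hα₀ hα
  have cG := hG1.cotMul hα₀ hα
  have hQ := weightedL1_convMellin hα₀ hα₁ hF1 hG1
  refine ⟨fun x hx => integrable_convKernel hα₀ hα₁ hF1 hG1 hx, fun τ => ?_,
    isMellin_invLine hQ.integrable (memLp_convMellin hα₀ hα₁ hF1 hG1 hf.2.1 hg.2.1)
      fun x hx => conv_eq_invLine hα₀ hα₁ hF1 hG1 hx, fun x hx => ?_, ?_, ?_,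
    fun _ _ x hx hfx hgx => ?_⟩
  · simp only [convMellinKernel_vpt]
    exact integrable_sub_mul (memLp_cotMul hα₀ hα hf.2.1) (memLp_cotMul hα₀ hα hg.2.1) τ
  · obtain ⟨f1, f2⟩ := halfHilbert_invLine hα₀ hα hF1 ef hx
    obtain ⟨g1, g2⟩ := halfHilbert_invLine hα₀ hα hG1 eg hx
    have ec : ∀ᵐ t ∂(volume.restrict (Ioi (0 : ℝ))), conv α F G t
        = invLine (2 * α) (fun τ => convMellin α F G (vpt (2 * α) τ)) t := by
      filter_upwards [ae_restrict_mem measurableSet_Ioi] with t ht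
      exact conv_eq_invLine hα₀ hα₁ hF1 hG1 ht
    obtain ⟨c1, c2⟩ := halfHilbert_invLine (by linarith) (by linarith) hQ ec hx
    refine ⟨f1, g1, c1, ?_⟩
    have e := invLine_mul_invLine (α := α) cF.integrable cG.integrable hx
    rw [c2, f2, g2]
    refine Eq.trans ?_ e.symm
    congr 1
    funext τ
    rw [convMellin_vpt, mul_inv_cancel_left₀ (cot_vpt_ne_zero (by linarith) (by linarith) τ)]
  · simpa only [mellinInversion_eq_invLine] using ef
  · simpa only [mellinInversion_eq_invLine] using eg
  · rw [mellinInversion_eq_invLine] at hfx hgx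
    exact conv_eq_repr hα₀ hα₁ hF1 hG1 hf.2.1 hg.2.1
      (aestronglyMeasurable_restrict_of_weightMeasure hf.1.1)
      (aestronglyMeasurable_restrict_of_weightMeasure hg.1.1) ef eg hx hfx hgx
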